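/- Let $N\ge 0$, let $P,Q\in\mathbb C[z_1,\dots,z_N]$ with $Q\neq 0$, let $U=\mathbb C^N\setminus Q^{-1}(0)$ and let $f=P/Q:U\to\mathbb C$. Let $S\subset U$ be a smooth quasi-affine subvariety, i.e. a smooth Zariski locally closed subset of $\mathbb C^N$ contained in $U$ (not necessarily irreducible, connected or equidimensional), and let $g=f|_S:S\to\mathbb C$. Write $\|z\|$ for the Hermitian norm on $\mathbb C^N$, let $S_{\mathbb R}$ be the underlying real manifold of $S$, and equip each tangent space $T_zS_{\mathbb R}\subset\mathbb C^N$ with the Euclidean inner product $\operatorname{Re}(u,v)$ induced from the Hermitian inner product $(u,v)$ of $\mathbb C^N$. For $z\in S$ let $\|d\operatorname{Re}g(z)\|$ be the norm of the vector $\operatorname{grad}\operatorname{Re}g(z)\in T_zS_{\mathbb R}$ that corresponds to $d\operatorname{Re}g(z)\in T^*_zS_{\mathbb R}$ under this inner product. Assume that $g$ is tame at infinity: there exist $R_0>0$ and $\varepsilon_0>0$ such that $$\{z\in S \mid \|d\operatorname{Re}g(z)\|<\varepsilon_0,\ \|z\|>R_0\}=\emptyset .$$ Let $\rho(z)=\tfrac12\|z\|^2$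 and $$M(g)=\{z\in S \mid d(\rho|_S)(z)\in\mathbb R\, d\operatorname{Re}g(z)+\mathbb R\, d\operatorname{Im}g(z)\}.$$ Then for every $\tau_0\in\mathbb C$ there exist $R>0$ and $\varepsilon>0$ such that $$M(g)\cap\{z\in S \mid |g(z)-\tau_0|<\varepsilon,\ \|z\|>R\}=\emptyset .$$ -/

import Mathlib

noncomputable section

namespace TameAtInfinity

/-- The affine space `ℂ^N` with its Hermitian norm. -/
abbrev AffSpace (N : ℕ) : Type := EuclideanSpace ℂ (Fin N)

/-- Polynomials in `N` complex variables. -/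
abbrev Poly (N : ℕ) : Type := MvPolynomial (Fin N) ℂ

/-- The value of a polynomial at a point. -/
def value {N : ℕ} (p : Poly N) (z : AffSpace N) : ℂ :=
  MvPolynomial.eval (fun j => z j) p

/-- The vector of complex partial derivatives of a polynomial at a point. -/
def partials {N : ℕ} (p : Poly N) (z : AffSpace N) : Fin N → ℂ :=
  fun j => value (MvPolynomial.pderiv j p) z

/-- Zariski locally closed subsets of `ℂ^N`: the points of a Zariski closed set
which do not lie on another Zariski closed set. -/
def IsQuasiAffine {N : ℕ} (S : Set (AffSpace N)) : Prop :=
  ∃ A B : Finset (Poly N),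
    S = {z | ∀ p ∈ A, value p z = 0} \ {z | ∀ q ∈ B, value q z = 0}

/-- Smoothness at each point of the (reduced) variety `S` in `ℂ^N`: in a Zariski open
neighbourhood `{u ≠ 0}` of the point, `S` is the zero set of polynomials whose
differentials are linearly independent at the point (Jacobian criterion). The number of
equations may depend on the point, so that `S` need not be connected or equidimensional. -/
def IsSmoothVariety {N : ℕ} (S : Set (AffSpace N)) : Prop :=
  ∀ z ∈ S, ∃ (k : ℕ) (h : Fin k → Poly N) (u : Poly N),
    value u z ≠ 0 ∧
    (∀ x : AffSpace N, value u x ≠ 0 → (x ∈ S ↔ ∀ i, value (h i) x = 0)) ∧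
    LinearIndependent ℂ (fun i => partials (h i) z)

/-- The (Zariski) tangent space `T_z S` as a complex subspace of `T_z ℂ^N = ℂ^N`: the common
kernel of the differentials at `z` of all polynomials that vanish on `S`. -/
def tangentSpace {N : ℕ} (S : Set (AffSpace N)) (z : AffSpace N) :
    Submodule ℂ (AffSpace N) where
  carrier := {v | ∀ p : Poly N, (∀ x ∈ S, value p x = 0) → ∑ j, partials p z j * v j = 0}
  zero_mem' := by intro p _; simp
  add_mem' := by
    intro v w hv hw p hp
    simp [mul_add, Finset.sum_add_distrib, hv p hp, hw p hp]
  smul_mem' := by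
    intro c v hv p hp
    have h := congrArg (fun t => c * t) (hv p hp)
    simpa [Finset.mul_sum, mul_left_comm] using h

/-- `T_z S` as a real vector space, with the Euclidean structure induced from `ℂ^N = ℝ^{2N}`. -/
abbrev realTangentSpace {N : ℕ} (S : Set (AffSpace N)) (z : AffSpace N) :
    Submodule ℝ (AffSpace N) :=
  (tangentSpace S z).restrictScalars ℝ

/-- The differential `d(φ|_S)(z) ∈ T_z^* S_ℝ` of the restriction to `S` of a real function `φ`
defined and differentiable near `z` in `ℂ^N`. -/
def diffOn {N : ℕ} (S : Set (AffSpace N)) (φ : AffSpace N → ℝ) (z : AffSpace N) :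
    StrongDual ℝ (realTangentSpace S z) :=
  (fderiv ℝ φ z).comp (realTangentSpace S z).subtypeL

/-- The gradient `grad(φ|_S)(z) ∈ T_z S_ℝ`, the vector which corresponds to `d(φ|_S)(z)` under
the isomorphism `T_z S_ℝ ≃ T_z^* S_ℝ` given by the induced Euclidean metric. -/
def gradOn {N : ℕ} (S : Set (AffSpace N)) (φ : AffSpace N → ℝ) (z : AffSpace N) :
    realTangentSpace S z :=
  (InnerProductSpace.toDual ℝ (realTangentSpace S z)).symm (diffOn S φ z)

/-- The rational function `P / Q`, used only where `Q` does not vanish. -/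
def ratFun {N : ℕ} (P Q : Poly N) (z : AffSpace N) : ℂ := value P z / value Q z

/-- Tameness at infinity of `g = f|_S`: there are `R` and `ε > 0` such that no point of `S`
has `‖d Re g(z)‖ < ε` and `‖z‖ > R`. -/
def IsTameAtInfinity {N : ℕ} (S : Set (AffSpace N)) (f : AffSpace N → ℂ) : Prop :=
  ∃ R > (0 : ℝ), ∃ ε > (0 : ℝ),
    {z | z ∈ S ∧ ‖gradOn S (fun x => (f x).re) z‖ < ε ∧ ‖z‖ > R} = ∅

/-- The set `M(g)`, for `g = f|_S`, of the points of `S` at which the differential of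
`‖z‖² / 2` on `S` is a real linear combination of `d Re g` and `d Im g`. -/
def milnorSet {N : ℕ} (S : Set (AffSpace N)) (f : AffSpace N → ℂ) : Set (AffSpace N) :=
  {z | z ∈ S ∧ diffOn S (fun x => ‖x‖ ^ 2 / 2) z ∈
    Submodule.span ℝ {diffOn S (fun x => (f x).re) z, diffOn S (fun x => (f x).im) z}}

end TameAtInfinity

end

/-! ### Ordered fields: lowering a transcendental coordinate. -/

noncomputable section

open Polynomial IntermediateField Topology Filter

namespace TameAtInfinity

/-! If the conclusion fails at `τ₀`, then `M(g)` has points of arbitrarily large norm with `|g - τ₀|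
< 1`. Together with Lagrange multipliers and slack variables, such points form a real algebraic set
(`milnorSystem`). A curve in it going to infinity, parametrised by `t = ‖z‖`, would have `dg/dt →
0`, since `g` is bounded on it. Let `w` be its velocity at a far point `z`: then `Re(z,w) = ‖z‖` and
`|dg(w)| < ε₀`. Membership in `M(g)` means that the functional of `z` equals `c·dg` on `T_zS` for
some complex `c`, so `‖z‖ ≤ |c||dg(w)| < |c|ε₀ ≤ |c|‖grad Re g‖`. Pairing with the gradient gives
`|c|‖grad Re g‖ ≤ ‖z‖` (`norm_mul_norm_gradOn_le`), a contradiction.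

Only `z` and `w` are needed, and `exists_tangent_vector` finds them without a curve. An unbounded
sequence of points is one point over the hyperreals with an infinite coordinate `t`. It can be
replaced by a point algebraic over `ℝ(t)` (`exists_zero_of_exists_zero_hyperreal`): distances from
nearest solutions are algebraic, because a transcendental one could be lowered
(`exists_lt_of_transcendental`). A derivation `D` with `D t = 1` (`exists_derivation_eq_one`)
supplies the velocity, and `D` sends bounded algebraic coordinates to infinitesimals
(`derivation_lt_of_bounded`). Reading everything off at one index gives real data. -/

theorem exists_neg_pos_of_simple_root {K : Type*} [Field K] [LinearOrder K]
    [IsStrictOrderedRing K] {p : K[X]} {θ : K} (h0 : p.eval θ = 0)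
    (h1 : p.derivative.eval θ ≠ 0) : ∃ a b, p.eval a < 0 ∧ 0 < p.eval b := by
  obtain ⟨q, rfl⟩ : X - C θ ∣ p := dvd_iff_isRoot.2 h0
  let : TopologicalSpace K := Preorder.topology K
  have : OrderTopology K := ⟨rfl⟩
  have hq : q.eval θ ≠ 0 := by simpa using h1
  have hc : ContinuousAt (fun x => q.eval x) θ := q.continuous.continuousAt
  -- The cofactor `q` keeps its sign near `θ`, while `X - θ` changes sign.
  rcases lt_or_gt_of_ne hq with hq | hq
  · have ev := hc.eventually (gt_mem_nhds hq)
    obtain ⟨l, hl, hl'⟩ := exists_Ioc_subset_of_mem_nhds ev (exists_lt θ)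
    obtain ⟨u, hu, hu'⟩ := exists_Ico_subset_of_mem_nhds ev (exists_gt θ)
    obtain ⟨a, ha, ha'⟩ := exists_between hl
    obtain ⟨b, hb, hb'⟩ := exists_between hu
    refine ⟨b, a, ?_, ?_⟩
    · have : q.eval b < 0 := hu' ⟨hb.le, hb'⟩
      simpa using mul_neg_of_pos_of_neg (sub_pos.2 hb) this
    · have : q.eval a < 0 := hl' ⟨ha, ha'.le⟩
      simpa using mul_pos_of_neg_of_neg (sub_neg.2 ha') this
  · have ev := hc.eventually (lt_mem_nhds hq)
    obtain ⟨l, hl, hl'⟩ := exists_Ioc_subset_of_mem_nhds ev (exists_lt θ)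
    obtain ⟨u, hu, hu'⟩ := exists_Ico_subset_of_mem_nhds ev (exists_gt θ)
    obtain ⟨a, ha, ha'⟩ := exists_between hl
    obtain ⟨b, hb, hb'⟩ := exists_between hu
    refine ⟨a, b, ?_, ?_⟩
    · have : 0 < q.eval a := hl' ⟨ha, ha'.le⟩
      simpa using mul_neg_of_neg_of_pos (sub_neg.2 ha') this
    · have : 0 < q.eval b := hu' ⟨hb.le, hb'⟩
      simpa using mul_pos (sub_pos.2 hb) this

/-- Two points of the interval that determine `y` rationally cannot both be algebraic. -/
theorem exists_transcendental_mem_Ioo {k K : Type*} [Field k] [Field K] [LinearOrder K]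
    [IsStrictOrderedRing K] [Algebra k K] {y l : K} (hy : Transcendental k y) (hl : l < y) :
    ∃ y', l < y' ∧ y' < y ∧ Transcendental k y' := by
  by_contra! H
  have h1 : IsAlgebraic k (y - (y - l) / 2) := by
    by_contra h
    exact H _ (by linarith) (by linarith) h
  have h2 : IsAlgebraic k (y - (y - l) / 4) := by
    by_contra h
    exact H _ (by linarith) (by linarith) h
  apply hy
  have e : y = (y - (y - l) / 4) + ((y - (y - l) / 4) - (y - (y - l) / 2)) := by ring
  rw [e]
  exact h2.add (h2.sub h1)

/-- The isomorphism of simple transcendental extensions carrying `y` to `y'`. -/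
def transcendentalHom {k K : Type*} [Field k] [Field K] [Algebra k K] {y y' : K}
    (hy : Transcendental k y) (hy' : Transcendental k y') : k⟮y⟯ →ₐ[k] K :=
  (k⟮y'⟯.val.comp (RatFunc.algEquivOfTranscendental y' hy').toAlgHom).comp
    (RatFunc.algEquivOfTranscendental y hy).symm.toAlgHom

theorem transcendentalHom_apply {k K : Type*} [Field k] [Field K] [Algebra k K] {y y' : K}
    (hy : Transcendental k y) (hy' : Transcendental k y') (c : k⟮y⟯) :
    transcendentalHom hy hy' c =
      aeval y' ((RatFunc.algEquivOfTranscendental y hy).symm c).num /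
      aeval y' ((RatFunc.algEquivOfTranscendental y hy).symm c).denom := by
  simp only [transcendentalHom, AlgHom.comp_apply]
  exact RatFunc.algEquivOfTranscendental_apply y' hy' _

theorem transcendentalHom_gen {k K : Type*} [Field k] [Field K] [Algebra k K] {y y' : K}
    (hy : Transcendental k y) (hy' : Transcendental k y') :
    transcendentalHom hy hy' (AdjoinSimple.gen k y) = y' := by
  simp [transcendentalHom]

/-- Adjoining all `x i` to `k(y)` gives a field `k(y)(α)`. The minimal polynomial of `α` changes
sign near this simple root, and its coefficients are rational functions of `y`. For a transcendental
`y'` slightly below `y` the sign change persists, so `ivt` gives a root. Sending `y` to `y'` and `α`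
to that root defines a `k`-homomorphism, which preserves equations over `k`. -/
theorem exists_specialization {k K : Type*} [Field k] [Field K] [LinearOrder K]
    [IsStrictOrderedRing K] [Algebra k K]
    (ivt : ∀ (p : K[X]) (a b : K), p.eval a < 0 → 0 < p.eval b → ∃ c, p.eval c = 0)
    {σ : Type*} [Finite σ] (x : σ → K) (i₀ : σ) (hy : Transcendental k (x i₀))
    (halg : Algebra.IsAlgebraic k⟮x i₀⟯ K) :
    ∃ x' : σ → K, x' i₀ < x i₀ ∧
      ∀ p : MvPolynomial σ k, MvPolynomial.aeval x p = 0 → MvPolynomial.aeval x' p = 0 := by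
  generalize hyx : x i₀ = y at *
  let M := k⟮y⟯
  let L := IntermediateField.adjoin M (Set.range x)
  have : FiniteDimensional M L :=
    IntermediateField.finiteDimensional_adjoin fun z _ => (halg.isAlgebraic z).isIntegral
  have : CharZero M := (algebraMap M K).charZero
  obtain ⟨α, hα⟩ := Field.exists_primitive_element M L
  have hint : IsIntegral M α := Algebra.IsIntegral.isIntegral α
  set m := minpoly M α with hm
  have hsep : m.Separable := (minpoly.irreducible hint).separable
  have h0 : (m.map (algebraMap M K)).eval (α : K) = 0 := by
    have := congrArg (algebraMap L K) (minpoly.aeval M α)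
    rw [← aeval_algebraMap_apply, map_zero] at this
    rw [eval_map_algebraMap]
    exact this
  have h1 : (m.map (algebraMap M K)).derivative.eval (α : K) ≠ 0 := by
    have := (hsep.map (f := algebraMap M K)).eval₂_derivative_ne_zero (RingHom.id K) (x := (α : K))
      (by rwa [eval₂_id])
    rwa [eval₂_id] at this
  obtain ⟨a, b, ha, hb⟩ := exists_neg_pos_of_simple_root h0 h1
  let : TopologicalSpace K := Preorder.topology K
  have : OrderTopology K := ⟨rfl⟩
  -- The value at `θ` of `m` with `y` replaced by `y'`, written so that it makes sense for every
  -- `y'` and its continuity can be used.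
  let G : K → K → K := fun θ y' => ∑ i ∈ Finset.range (m.natDegree + 1),
      (aeval y' ((RatFunc.algEquivOfTranscendental y hy).symm (m.coeff i)).num /
      aeval y' ((RatFunc.algEquivOfTranscendental y hy).symm (m.coeff i)).denom) * θ ^ i
  have hG : ∀ (θ y' : K) (hy' : Transcendental k y'),
      (m.map (transcendentalHom hy hy').toRingHom).eval θ = G θ y' := by
    intro θ y' hy'
    rw [eval_map, eval₂_eq_sum_range]
    exact Finset.sum_congr rfl fun i _ => by
      congr 1; exact transcendentalHom_apply hy hy' _
  have hid : ∀ c : M, transcendentalHom hy hy c = c := by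
    intro c
    simp [transcendentalHom]
  have hG' : ∀ θ, (m.map (algebraMap M K)).eval θ = G θ y := by
    intro θ
    rw [← hG θ y hy]
    congr 2
    ext c
    exact (hid c).symm
  have hcont : ∀ θ, ContinuousAt (G θ) y := by
    intro θ
    refine tendsto_finsetSum _ fun i _ => ?_
    refine Tendsto.mul_const _ (Tendsto.div ?_ ?_ ?_)
    · exact (Polynomial.continuous_aeval _).continuousAt
    · exact (Polynomial.continuous_aeval _).continuousAt
    · intro h
      exact RatFunc.denom_ne_zero _ ((transcendental_iff.1 hy) _ h)
  rw [hG'] at ha hb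
  have ev := ((hcont a).eventually (gt_mem_nhds ha)).and ((hcont b).eventually (lt_mem_nhds hb))
  obtain ⟨l, hl, hl'⟩ := exists_Ioc_subset_of_mem_nhds ev (exists_lt y)
  obtain ⟨y', hly, hyy, hy'⟩ := exists_transcendental_mem_Ioo hy hl
  obtain ⟨ha', hb'⟩ := hl' ⟨hly, hyy.le⟩
  rw [← hG a y' hy'] at ha'
  rw [← hG b y' hy'] at hb'
  obtain ⟨c, hc⟩ := ivt _ a b ha' hb'
  rw [eval_map] at hc
  let ψ : AdjoinRoot m →+* K := AdjoinRoot.lift (transcendentalHom hy hy').toRingHom c hc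
  let e : AdjoinRoot m ≃ₐ[M] M⟮α⟯ := adjoinRootEquivAdjoin M hint
  let j : AdjoinRoot m →ₐ[M] K := (L.val.comp M⟮α⟯.val).comp e.toAlgHom
  have hj : Function.Injective j :=
    (L.val.injective.comp M⟮α⟯.val.injective).comp e.injective
  have hsurj : ∀ i, ∃ ξ, j ξ = x i := by
    intro i
    have hx : x i ∈ L := IntermediateField.subset_adjoin _ _ ⟨i, rfl⟩
    have hx' : (⟨x i, hx⟩ : L) ∈ M⟮α⟯ := by rw [hα]; trivial
    exact ⟨e.symm ⟨⟨x i, hx⟩, hx'⟩, by simp [j]⟩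
  choose ξ hξ using hsurj
  have hψk : ∀ r : k, ψ (algebraMap k (AdjoinRoot m) r) = algebraMap k K r := by
    intro r
    rw [IsScalarTower.algebraMap_apply k M (AdjoinRoot m), AdjoinRoot.algebraMap_eq,
      AdjoinRoot.lift_of]
    exact (transcendentalHom hy hy').commutes r
  let ψ' : AdjoinRoot m →ₐ[k] K := { ψ with commutes' := hψk }
  refine ⟨fun i => ψ' (ξ i), ?_, fun p hp => ?_⟩
  · have : ξ i₀ = algebraMap M (AdjoinRoot m) (AdjoinSimple.gen k y) := by
      apply hj
      rw [hξ, j.commutes, hyx]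
      rfl
    have h2 : ψ' (ξ i₀) = y' := by
      rw [this, AdjoinRoot.algebraMap_eq]
      change ψ _ = _
      rw [AdjoinRoot.lift_of]
      exact transcendentalHom_gen hy hy'
    change ψ' (ξ i₀) < y
    rw [h2]; exact hyy
  · have hz : MvPolynomial.aeval ξ p = 0 := by
      apply hj
      rw [map_zero]
      have h3 : (j.restrictScalars k) (MvPolynomial.aeval ξ p) = MvPolynomial.aeval x p := by
        rw [← AlgHom.comp_apply, MvPolynomial.comp_aeval]
        congr 2
        funext i; exact hξ i
      exact h3.trans hp
    have h4 : ψ' (MvPolynomial.aeval ξ p) = MvPolynomial.aeval (fun i => ψ' (ξ i)) p := by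
      rw [← AlgHom.comp_apply, MvPolynomial.comp_aeval]
    rw [← h4, hz, map_zero]

end TameAtInfinity
end

/-! ### Transcendence bases and derivations. -/

noncomputable section

open Polynomial IntermediateField Topology Filter

namespace TameAtInfinity

/-- Extend `{y}` to a transcendence basis and adjoin its other members to `k`. -/
theorem exists_transcendental_isAlgebraic {k K : Type*} [Field k] [Field K] [Algebra k K] {y : K}
    (hy : Transcendental k y) : ∃ k' : IntermediateField k K,
      Transcendental k' y ∧ Algebra.IsAlgebraic k'⟮y⟯ K := by
  have h1 : AlgebraicIndepOn k id ({y} : Set K) := by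
    exact (algebraicIndependent_singleton_iff (⟨y, rfl⟩ : ({y} : Set K))).2 hy
  obtain ⟨B, hyB, hB⟩ := exists_isTranscendenceBasis_superset h1
  have hyB : y ∈ B := hyB rfl
  have hins : insert y (B \ {y}) = B := by simp [hyB]
  have h2 : AlgebraicIndepOn k id (insert y (B \ {y})) := by
    rw [hins]; exact hB.1
  rw [AlgebraicIndepOn.insert_iff (by simp)] at h2
  refine ⟨IntermediateField.adjoin k (B \ {y}), ?_, ?_⟩
  · intro h
    apply h2.2
    rw [Set.image_id]
    exact IntermediateField.isAlgebraic_adjoin_iff.1 h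
  · have h3 := hB.isAlgebraic_field
    rw [Subtype.range_coe] at h3
    refine ⟨fun a => ?_⟩
    have h4 : IsAlgebraic (IntermediateField.restrictScalars k
        (IntermediateField.adjoin k (B \ {y}))⟮y⟯).toSubalgebra a := by
      refine IsAlgebraic.tower_top_of_subalgebra_le (A := (IntermediateField.adjoin k B).toSubalgebra)
        ?_ (h3.isAlgebraic a)
      rw [IntermediateField.adjoin_adjoin_left, Set.sdiff_union_of_subset (by simpa using hyB)]
    exact h4

theorem exists_ringHom_section {A K B : Type*} [CommRing A] [CommRing K] [CommRing B] [Algebra A K]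
    [Algebra.FormallySmooth A K] (π : B →+* K) (hπ : Function.Surjective π)
    (hker : RingHom.ker π ^ 2 = ⊥) (j : A →+* B) (hj : π.comp j = algebraMap A K) :
    ∃ s : K →+* B, s.comp (algebraMap A K) = j ∧ π.comp s = RingHom.id K := by
  let := j.toAlgebra
  let g : B →ₐ[A] K := { π with commutes' := fun r => congrArg (· r) hj }
  have hn : IsNilpotent (RingHom.ker (g : B →+* K)) := ⟨2, hker⟩
  let s := Algebra.FormallySmooth.liftOfSurjective (AlgHom.id A K) g hπ hn
  refine ⟨s, ?_, ?_⟩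
  · ext r
    exact s.commutes r
  · ext x
    exact Algebra.FormallySmooth.liftOfSurjective_apply (AlgHom.id A K) g hπ hn x

-- `K` is formally smooth over `k'[y]`, being a separable algebraic extension of a localization. So
-- the map `y ↦ y + ε` into the dual numbers over `K` extends to a section of their projection to
-- `K`; its `ε`-component is the derivation.
open scoped IntermediateField.algebraAdjoinAdjoin in
theorem exists_derivation_eq_one {k K : Type*} [Field k] [Field K] [Algebra k K] [CharZero K] {y : K}
    (hy : Transcendental k y) : ∃ D : Derivation k K K, D y = 1 := by
  obtain ⟨k', hy', halg⟩ := exists_transcendental_isAlgebraic hy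
  have : CharZero k'⟮y⟯ := (algebraMap k'⟮y⟯ K).charZero
  have : Algebra.FormallySmooth (Algebra.adjoin k' {y}) k'⟮y⟯ :=
    Algebra.FormallySmooth.of_isLocalization (nonZeroDivisors _)
  have : Algebra.FormallyEtale k'⟮y⟯ K := Algebra.FormallyEtale.of_isSeparable _ _
  have : Algebra.FormallySmooth (Algebra.adjoin k' {y}) K :=
    Algebra.FormallySmooth.comp _ k'⟮y⟯ _
  let e := Polynomial.algEquivOfTranscendental k' y hy'
  let j₀ : k'[X] →+* DualNumber K :=
    (aeval (R := k') ((TrivSqZeroExt.inl y + TrivSqZeroExt.inr 1 : DualNumber K))).toRingHom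
  let π : DualNumber K →+* K := (TrivSqZeroExt.fstHom K K K).toRingHom
  obtain ⟨s, hs1, hs2⟩ := exists_ringHom_section (A := Algebra.adjoin k' {y}) π
    (fun x => ⟨TrivSqZeroExt.inl x, rfl⟩) (by
      rw [eq_bot_iff, pow_two, Ideal.mul_le]
      intro a ha b hb
      have ha : a.fst = 0 := ha
      have hb : b.fst = 0 := hb
      ext <;> simp [ha, hb]) (j₀.comp e.symm.toRingHom) (by
      have : (π.comp j₀) = (aeval (R := k') y).toRingHom := by
        ext <;> simp [π, j₀]
      ext z
      obtain ⟨p, rfl⟩ := e.surjective z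
      have h2 := congrArg (· p) this
      have h3 : ((e p : Algebra.adjoin k' {y}) : K) = aeval y p := by
        simp [e]
      change π (j₀ (e.symm (e p))) = ((e p : Algebra.adjoin k' {y}) : K)
      rw [e.symm_apply_apply, h3]
      exact h2)
  have hfst : ∀ x, (s x).fst = x := fun x => congrArg (· x) hs2
  have hsk : ∀ c : k, s (algebraMap k K c) = TrivSqZeroExt.inl (algebraMap k K c) := by
    intro c
    have h1 := congrArg (· (algebraMap k' (Algebra.adjoin k' {y}) (algebraMap k k' c))) hs1
    change s (algebraMap k K c) = j₀ (e.symm (algebraMap k' _ _)) at h1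
    rw [h1, e.symm.commutes]
    change aeval _ (C _) = _
    rw [aeval_C]
    rfl
  let D₀ : K →ₗ[k] K :=
    { toFun := fun x => (s x).snd
      map_add' := fun a b => by simp
      map_smul' := fun c a => by
        simp [Algebra.smul_def, hsk, hfst] }
  refine ⟨Derivation.mk' D₀ fun a b => ?_, ?_⟩
  · simp [D₀, hfst, mul_comm]
  · have h1 := congrArg (· (e X)) hs1
    have h3 : ((e X : Algebra.adjoin k' {y}) : K) = y := by simp [e]
    change s (e X : Algebra.adjoin k' {y}) = j₀ (e.symm (e X)) at h1
    rw [h3, e.symm_apply_apply] at h1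
    change (s y).snd = 1
    rw [h1]
    simp [j₀]

end TameAtInfinity
end

/-! ### Transfer from the reals to the hyperreals. -/

noncomputable section

open Polynomial IntermediateField Topology Filter

namespace TameAtInfinity

/-- A transcendental coordinate of a point over `k` can be decreased
while preserving all polynomial equations over `k`. -/
theorem exists_lt_of_transcendental {k K : Type*} [Field k] [Field K] [LinearOrder K]
    [IsStrictOrderedRing K] [Algebra k K]
    (ivt : ∀ (p : K[X]) (a b : K), p.eval a < 0 → 0 < p.eval b → ∃ c, p.eval c = 0)
    {σ : Type*} [Finite σ] (x : σ → K) (i₀ : σ) (hy : Transcendental k (x i₀)) :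
    ∃ x' : σ → K, x' i₀ < x i₀ ∧
      ∀ p : MvPolynomial σ k, MvPolynomial.aeval x p = 0 → MvPolynomial.aeval x' p = 0 := by
  -- Enlarging `k` only adds equations to be preserved, so `K` may be taken algebraic over `k(y)`.
  obtain ⟨k', hy', halg⟩ := exists_transcendental_isAlgebraic hy
  obtain ⟨x', hlt, hx'⟩ := exists_specialization ivt x i₀ hy' halg
  refine ⟨x', hlt, fun p hp => ?_⟩
  have := hx' (MvPolynomial.map (algebraMap k k') p)
  rw [MvPolynomial.aeval_map_algebraMap, MvPolynomial.aeval_map_algebraMap] at this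
  exact this hp

theorem mvPolynomial_hom_eval {R S σ : Type*} [CommSemiring R] [CommSemiring S] (φ : R →+* S)
    (f : σ → R) (p : MvPolynomial σ R) :
    φ (MvPolynomial.eval f p) = MvPolynomial.eval (fun i => φ (f i)) (MvPolynomial.map φ p) := by
  induction p using MvPolynomial.induction_on with
  | C a => simp
  | add p q hp hq => simp [hp, hq]
  | mul_X p i hp => simp [hp]

/-- The hyperreal number represented by a sequence, as a ring homomorphism. -/
def seqHom : (ℕ → ℝ) →+* ℝ* := Germ.coeRingHom (hyperfilter ℕ : Filter ℕ)

theorem seqHom_surjective : Function.Surjective seqHom := Hyperreal.ofSeq_surjective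

theorem seqHom_lt {f g : ℕ → ℝ} : seqHom f < seqHom g ↔ ∀ᶠ n in hyperfilter ℕ, f n < g n :=
  Hyperreal.ofSeq_lt_ofSeq

theorem seqHom_le {f g : ℕ → ℝ} : seqHom f ≤ seqHom g ↔ ∀ᶠ n in hyperfilter ℕ, f n ≤ g n :=
  Hyperreal.ofSeq_le_ofSeq

theorem seqHom_eq {f g : ℕ → ℝ} : seqHom f = seqHom g ↔ ∀ᶠ n in hyperfilter ℕ, f n = g n :=
  Germ.coe_eq

instance hyperrealAlgebra : Algebra ℝ ℝ* := (seqHom.comp (Pi.constRingHom ℕ ℝ)).toAlgebra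

theorem algebraMap_eq_seqHom (r : ℝ) : algebraMap ℝ ℝ* r = seqHom fun _ => r := rfl

theorem seqHom_eval {σ : Type*} (f : σ → ℕ → ℝ) (p : MvPolynomial σ (ℕ → ℝ)) :
    MvPolynomial.eval (fun i => seqHom (f i)) (MvPolynomial.map seqHom p) =
      seqHom fun n => MvPolynomial.eval (fun i => f i n)
        (MvPolynomial.map (Pi.evalRingHom (fun _ => ℝ) n) p) := by
  rw [← mvPolynomial_hom_eval]
  congr 1
  funext n
  exact mvPolynomial_hom_eval (Pi.evalRingHom (fun _ => ℝ) n) f p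

/-- The real intermediate value theorem is applied at each index; indices without a sign change are
negligible and receive an arbitrary value. -/
theorem hyperreal_ivt (p : ℝ*[X]) (a b : ℝ*) (ha : p.eval a < 0) (hb : 0 < p.eval b) :
    ∃ c, p.eval c = 0 := by
  obtain ⟨p, rfl⟩ := Polynomial.map_surjective seqHom seqHom_surjective p
  obtain ⟨a, rfl⟩ := seqHom_surjective a
  obtain ⟨b, rfl⟩ := seqHom_surjective b
  have key : ∀ c : ℕ → ℝ, (p.map seqHom).eval (seqHom c) =
      seqHom fun n => (p.map (Pi.evalRingHom (fun _ => ℝ) n)).eval (c n) := by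
    intro c
    rw [Polynomial.eval_map_apply]
    congr 1
    funext n
    have := Polynomial.eval_map_apply (f := Pi.evalRingHom (fun _ => ℝ) n) (p := p) c
    exact this.symm
  rw [key, ← map_zero seqHom, seqHom_lt] at ha hb
  have h : ∀ n, ∃ c, (p.map (Pi.evalRingHom (fun _ => ℝ) n)).eval (a n) < 0 →
      0 < (p.map (Pi.evalRingHom (fun _ => ℝ) n)).eval (b n) →
      (p.map (Pi.evalRingHom (fun _ => ℝ) n)).eval c = 0 := by
    intro n
    by_cases h : (p.map (Pi.evalRingHom (fun _ => ℝ) n)).eval (a n) < 0 ∧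
        0 < (p.map (Pi.evalRingHom (fun _ => ℝ) n)).eval (b n)
    · obtain ⟨c, hc⟩ := mem_range_of_exists_le_of_exists_ge
        (p.map (Pi.evalRingHom (fun _ => ℝ) n)).continuous ⟨_, h.1.le⟩ ⟨_, h.2.le⟩
      exact ⟨c, fun _ _ => hc⟩
    · exact ⟨0, fun h1 h2 => absurd ⟨h1, h2⟩ h⟩
  choose c hc using h
  refine ⟨seqHom c, ?_⟩
  rw [key, ← map_zero seqHom, seqHom_eq]
  filter_upwards [ha, hb] with n h1 h2
  exact hc n h1 h2

theorem exists_min_sum_sq_real {σ : Type*} [Fintype σ] (p : MvPolynomial σ ℝ) (a x₀ : σ → ℝ)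
    (h : MvPolynomial.eval x₀ p = 0) : ∃ x, MvPolynomial.eval x p = 0 ∧
      ∀ y, MvPolynomial.eval y p = 0 → ∑ i, (x i - a i) ^ 2 ≤ ∑ i, (y i - a i) ^ 2 := by
  let s : Set (EuclideanSpace ℝ σ) := {x | MvPolynomial.eval (fun i => x i) p = 0}
  have hs : IsClosed s := by
    refine isClosed_eq ?_ continuous_const
    exact (MvPolynomial.continuous_eval p).comp (by fun_prop)
  obtain ⟨x, hx, hd⟩ := hs.exists_infDist_eq_dist ⟨WithLp.toLp 2 x₀, h⟩ (WithLp.toLp 2 a)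
  refine ⟨fun i => x i, hx, fun y hy => ?_⟩
  have h1 := Metric.infDist_le_dist_of_mem (x := WithLp.toLp 2 a)
    (show (WithLp.toLp 2 y : EuclideanSpace ℝ σ) ∈ s from hy)
  rw [hd, dist_comm, dist_comm _ (WithLp.toLp 2 y), EuclideanSpace.dist_eq, EuclideanSpace.dist_eq,
    Real.sqrt_le_sqrt_iff (Finset.sum_nonneg fun _ _ => sq_nonneg _)] at h1
  simpa [Real.dist_eq, sq_abs] using h1

theorem exists_min_sum_sq {σ : Type*} [Fintype σ] (p : MvPolynomial σ ℝ*) (a x₀ : σ → ℝ*)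
    (h : MvPolynomial.eval x₀ p = 0) : ∃ x, MvPolynomial.eval x p = 0 ∧
      ∀ y, MvPolynomial.eval y p = 0 → ∑ i, (x i - a i) ^ 2 ≤ ∑ i, (y i - a i) ^ 2 := by
  obtain ⟨p, rfl⟩ := MvPolynomial.map_surjective seqHom seqHom_surjective p
  have lift : ∀ x : σ → ℝ*, ∃ f : σ → ℕ → ℝ, x = fun i => seqHom (f i) := fun x => by
    choose f hf using fun i => seqHom_surjective (x i)
    exact ⟨f, funext fun i => (hf i).symm⟩
  obtain ⟨a, rfl⟩ := lift a
  obtain ⟨x₀, rfl⟩ := lift x₀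
  have hmin : ∀ n, ∃ x : σ → ℝ,
      MvPolynomial.eval (fun i => x₀ i n) (MvPolynomial.map (Pi.evalRingHom (fun _ => ℝ) n) p) = 0 →
      MvPolynomial.eval x (MvPolynomial.map (Pi.evalRingHom (fun _ => ℝ) n) p) = 0 ∧
      ∀ y, MvPolynomial.eval y (MvPolynomial.map (Pi.evalRingHom (fun _ => ℝ) n) p) = 0 →
        ∑ i, (x i - a i n) ^ 2 ≤ ∑ i, (y i - a i n) ^ 2 := by
    intro n
    by_cases h : MvPolynomial.eval (fun i => x₀ i n)
        (MvPolynomial.map (Pi.evalRingHom (fun _ => ℝ) n) p) = 0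
    · obtain ⟨x, hx⟩ := exists_min_sum_sq_real _ (fun i => a i n) _ h
      exact ⟨x, fun _ => hx⟩
    · exact ⟨0, fun h' => absurd h' h⟩
  choose x hx using hmin
  rw [seqHom_eval, ← map_zero seqHom, seqHom_eq] at h
  refine ⟨fun i => seqHom fun n => x n i, ?_, fun y hy => ?_⟩
  · rw [seqHom_eval, ← map_zero seqHom, seqHom_eq]
    filter_upwards [h] with n hn
    exact (hx n hn).1
  · obtain ⟨y, rfl⟩ := lift y
    rw [seqHom_eval, ← map_zero seqHom, seqHom_eq] at hy
    simp only [← map_sub, ← map_pow, ← map_sum]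
    rw [seqHom_le]
    filter_upwards [h, hy] with n hn hyn
    simpa using (hx n hn).2 _ hyn

/-! ### Solutions over a subfield algebraically closed in the hyperreals. -/

/-- The polynomial `∑ (X i - a i) ^ 2`. -/
def sqDistPoly {σ k : Type*} [Fintype σ] [CommRing k] (a : σ → k) : MvPolynomial σ k :=
  ∑ i, (MvPolynomial.X i - MvPolynomial.C (a i)) ^ 2

theorem aeval_sqDistPoly {σ k K : Type*} [Fintype σ] [CommRing k] [CommRing K] [Algebra k K]
    (a : σ → k) (x : σ → K) :
    MvPolynomial.aeval x (sqDistPoly a) = ∑ i, (x i - algebraMap k K (a i)) ^ 2 := by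
  simp [sqDistPoly]

section

variable {k : Type*} [Field k] [Algebra k ℝ*] {σ : Type*} [Fintype σ]

/-- Take a solution nearest to `a`, with its squared distance as the extra coordinate `none`. Were
that coordinate transcendental, lowering it would produce a nearer solution. -/
theorem exists_zero_isAlgebraic_sum_sq (F : MvPolynomial σ k) (a : σ → k)
    (h : ∃ x : σ → ℝ*, MvPolynomial.aeval x F = 0) :
    ∃ x : σ → ℝ*, MvPolynomial.aeval x F = 0 ∧
      IsAlgebraic k (∑ i, (x i - algebraMap k ℝ* (a i)) ^ 2) := by
  obtain ⟨x₀, hx₀⟩ := h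
  have hF : ∀ x : σ → ℝ*, MvPolynomial.aeval x F =
      MvPolynomial.eval x (MvPolynomial.map (algebraMap k ℝ*) F) := fun x => by
    rw [MvPolynomial.eval_map, MvPolynomial.aeval_def]
  obtain ⟨x, hx, hmin⟩ := exists_min_sum_sq _ (fun i => algebraMap k ℝ* (a i)) x₀ (hF x₀ ▸ hx₀)
  refine ⟨x, (hF x).trans hx, ?_⟩
  by_contra htr
  let z : Option σ → ℝ* := fun o => o.elim (∑ i, (x i - algebraMap k ℝ* (a i)) ^ 2) x
  obtain ⟨z', hlt, hz'⟩ := exists_lt_of_transcendental hyperreal_ivt z none htr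
  have h1 := hz' (MvPolynomial.rename some F) (by
    rw [MvPolynomial.aeval_rename]; exact (hF x).trans hx)
  have h2 := hz' (MvPolynomial.rename some (sqDistPoly a) - MvPolynomial.X none) (by
    rw [map_sub, MvPolynomial.aeval_rename, aeval_sqDistPoly, MvPolynomial.aeval_X]
    simp [z])
  rw [MvPolynomial.aeval_rename, hF] at h1
  rw [map_sub, MvPolynomial.aeval_rename, aeval_sqDistPoly, MvPolynomial.aeval_X, sub_eq_zero] at h2
  have h3 := hmin _ h1
  rw [h2] at h3
  exact absurd hlt (not_lt.2 h3)

/-- Distances are fixed one at a time; over an ordered field each new condition merges into a single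
equation as a sum of squares. -/
theorem exists_subsystem (hk : ∀ x : ℝ*, IsAlgebraic k x → ∃ c : k, algebraMap k ℝ* c = x)
    (F : MvPolynomial σ k) (h : ∃ x : σ → ℝ*, MvPolynomial.aeval x F = 0) (l : List (σ → k)) :
    ∃ G : MvPolynomial σ k, (∃ x : σ → ℝ*, MvPolynomial.aeval x G = 0) ∧
      (∀ x : σ → ℝ*, MvPolynomial.aeval x G = 0 → MvPolynomial.aeval x F = 0) ∧
      ∀ a ∈ l, ∃ c : k, ∀ x : σ → ℝ*, MvPolynomial.aeval x G = 0 →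
        ∑ i, (x i - algebraMap k ℝ* (a i)) ^ 2 = algebraMap k ℝ* c := by
  induction l with
  | nil => exact ⟨F, h, fun _ => id, by simp⟩
  | cons a l ih =>
    obtain ⟨G, hG, hGF, hl⟩ := ih
    obtain ⟨x, hx, hxa⟩ := exists_zero_isAlgebraic_sum_sq G a hG
    obtain ⟨c, hc⟩ := hk _ hxa
    have key : ∀ y : σ → ℝ*,
        MvPolynomial.aeval y (G ^ 2 + (sqDistPoly a - MvPolynomial.C c) ^ 2) = 0 ↔
        MvPolynomial.aeval y G = 0 ∧
          ∑ i, (y i - algebraMap k ℝ* (a i)) ^ 2 = algebraMap k ℝ* c := by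
      intro y
      rw [map_add, map_pow, map_pow, map_sub, aeval_sqDistPoly, MvPolynomial.aeval_C,
        add_eq_zero_iff_of_nonneg (sq_nonneg _) (sq_nonneg _), sq_eq_zero_iff, sq_eq_zero_iff,
        sub_eq_zero]
    refine ⟨_, ⟨x, (key x).2 ⟨hx, hc.symm⟩⟩, fun y hy => hGF y ((key y).1 hy).1, ?_⟩
    intro b hb
    rcases List.mem_cons.1 hb with rfl | hb
    · exact ⟨c, fun y hy => ((key y).1 hy).2⟩
    · obtain ⟨c', hc'⟩ := hl b hb
      exact ⟨c', fun y hy => hc' y ((key y).1 hy).1⟩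

/-- A polynomial equation over a subfield which is algebraically closed in the hyperreals
has a solution in the subfield as soon as it has a hyperreal one. -/
theorem exists_zero_of_exists_zero_hyperreal
    (hk : ∀ x : ℝ*, IsAlgebraic k x → ∃ c : k, algebraMap k ℝ* c = x)
    (F : MvPolynomial σ k) (h : ∃ x : σ → ℝ*, MvPolynomial.aeval x F = 0) :
    ∃ x : σ → k, MvPolynomial.aeval (fun i => algebraMap k ℝ* (x i)) F = 0 := by
  classical
  -- Squared distances to `0` and to the unit vectors recover the coordinates: `x_i = (|x|² + 1 - |x
  -- - e_i|²) / 2`.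
  obtain ⟨G, ⟨x, hx⟩, hGF, hl⟩ := exists_subsystem hk F h
    (0 :: Finset.univ.toList.map fun i => Pi.single i 1)
  obtain ⟨c₀, hc₀⟩ := hl 0 (by simp)
  have hi : ∀ i, ∃ c : k, algebraMap k ℝ* c = x i := by
    intro i
    obtain ⟨c, hc⟩ := hl (Pi.single i 1) (by simp)
    have h0 := hc₀ x hx
    have h1 := hc x hx
    refine ⟨(c₀ + 1 - c) / 2, ?_⟩
    rw [map_div₀, map_sub, map_add, map_ofNat, ← h0, ← h1]
    have e : ∀ j, (x j - algebraMap k ℝ* ((Pi.single i 1 : σ → k) j)) ^ 2 =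
        x j ^ 2 + if j = i then 1 - 2 * x i else 0 := by
      intro j
      by_cases hj : j = i
      · subst hj; simp; ring
      · simp [hj]
    simp only [e, Finset.sum_add_distrib, Pi.zero_apply, map_zero, sub_zero]
    simp
  choose c hc using hi
  exact ⟨c, by simpa only [hc] using hGF x hx⟩

end

end TameAtInfinity
end

/-! ### Real plane curves. -/

noncomputable section

open Polynomial IntermediateField Topology Filter

namespace TameAtInfinity

theorem eventually_pos_of_hasDerivAt {g : ℝ → ℝ} {g' : ℝ} (hg : HasDerivAt g g' 0) (h0 : g 0 = 0)
    (h : 0 < g') : ∀ᶠ s in 𝓝[>] 0, 0 < g s := by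
  have h1 := (hasDerivAt_iff_tendsto_slope.1 hg).mono_left
    (nhdsWithin_mono 0 fun (x : ℝ) (hx : 0 < x) => hx.ne')
  filter_upwards [h1.eventually (lt_mem_nhds h), self_mem_nhdsWithin] with s hs hs0
  have hs0 : 0 < s := hs0
  rw [slope_def_field, h0, sub_zero, sub_zero] at hs
  exact (div_pos_iff_of_pos_right hs0).1 hs

/-- Following a plane curve with negative slope to the left. -/
theorem exists_zero_of_neg_slope {f fr fx : ℝ → ℝ → ℝ}
    (hf : ∀ r x, HasFDerivAt (fun p : ℝ × ℝ => f p.1 p.2)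
      (fr r x • ContinuousLinearMap.fst ℝ ℝ ℝ + fx r x • ContinuousLinearMap.snd ℝ ℝ ℝ) (r, x))
    (hfr : Continuous fun p : ℝ × ℝ => fr p.1 p.2) (hfx : Continuous fun p : ℝ × ℝ => fx p.1 p.2)
    {r₀ r₁ x₁ : ℝ} (hr : r₀ ≤ r₁) (hx : x₁ ≤ 0) (hf0 : ∀ r, r₀ ≤ r → f r 0 ≠ 0)
    (hreg : ∀ r x, r₀ ≤ r → f r x = 0 → fr r x ≠ 0 ∧ fx r x ≠ 0)
    (h1 : f r₁ x₁ = 0) (h1' : 0 ≤ fr r₁ x₁ * fx r₁ x₁) : ∃ x, x₁ ≤ x ∧ x ≤ 0 ∧ f r₀ x = 0 := by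
  have hfc : Continuous fun p : ℝ × ℝ => f p.1 p.2 :=
    continuous_iff_continuousAt.2 fun p => (hf p.1 p.2).continuousAt
  -- The curve points in the box with slope `-fr/fx ≤ 0`. One with least `r` must lie on `r = r₀`,
  -- for otherwise there is another to its left.
  let Z : Set (ℝ × ℝ) := (Set.Icc r₀ r₁ ×ˢ Set.Icc x₁ 0) ∩
    {p | f p.1 p.2 = 0 ∧ 0 ≤ fr p.1 p.2 * fx p.1 p.2}
  have hZ : IsCompact Z := (isCompact_Icc.prod isCompact_Icc).inter_right
    ((isClosed_eq hfc continuous_const).inter (isClosed_le continuous_const (hfr.mul hfx)))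
  obtain ⟨⟨r, x⟩, ⟨⟨⟨hr0, hr1⟩, hx1, hx0⟩, hfz, hs⟩, hmin⟩ := hZ.exists_isMinOn
    ⟨(r₁, x₁), ⟨⟨hr, le_rfl⟩, le_rfl, hx⟩, h1, h1'⟩ continuous_fst.continuousOn
  simp only at hr0 hr1 hx1 hx0 hfz hs
  rcases hr0.eq_or_lt with rfl | hlt
  · exact ⟨x, hx1, hx0, hfz⟩
  exfalso
  obtain ⟨hA, hB⟩ := hreg r x hr0 hfz
  have hxneg : x < 0 := lt_of_le_of_ne hx0 (by rintro rfl; exact hf0 r hr0 hfz)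
  have hpos : 0 < fr r x * fx r x := lt_of_le_of_ne hs (mul_ne_zero hA hB).symm
  -- Twice the steepness of the curve: the derivative of `f` along `(r - h, x + M h)` is `fr`, along
  -- `(r - h, x)` it is `-fr`, so a zero lies in between.
  set M := 2 * (fr r x / fx r x) with hM
  have hMpos : 0 < M := by
    have : 0 < fr r x / fx r x := by
      rcases pos_and_pos_or_neg_and_neg_of_mul_pos hpos with h | h
      · exact div_pos h.1 h.2
      · exact div_pos_of_neg_of_neg h.1 h.2
    positivity
  have hline : ∀ c : ℝ, HasDerivAt (fun h : ℝ => f (r - h) (x + c * h)) (-fr r x + c * fx r x) 0 := by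
    intro c
    have hγ : HasDerivAt (fun h : ℝ => (r - h, x + c * h)) (-1, c) 0 := by
      refine HasDerivAt.prodMk ?_ ?_
      · simpa using (hasDerivAt_id (0 : ℝ)).const_sub r
      · simpa using ((hasDerivAt_id (0 : ℝ)).const_mul c).const_add x
    have h2 : HasFDerivAt (fun p : ℝ × ℝ => f p.1 p.2)
      (fr r x • ContinuousLinearMap.fst ℝ ℝ ℝ + fx r x • ContinuousLinearMap.snd ℝ ℝ ℝ)
      ((fun h : ℝ => (r - h, x + c * h)) 0) := by simpa using hf r x
    have h3 := h2.comp_hasDerivAt 0 hγ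
    convert! h3 using 1
    simp
    ring
  have e1 : ∀ᶠ h in 𝓝[>] (0 : ℝ), 0 < -(fr r x) * f (r - h) x := by
    refine eventually_pos_of_hasDerivAt (g' := fr r x * fr r x) ?_ ?_ (mul_self_pos.2 hA)
    · have := (hline 0).const_mul (-(fr r x))
      simpa using this
    · simp [hfz]
  have e2 : ∀ᶠ h in 𝓝[>] (0 : ℝ), 0 < fr r x * f (r - h) (x + M * h) := by
    refine eventually_pos_of_hasDerivAt (g' := fr r x * fr r x) ?_ ?_ (mul_self_pos.2 hA)
    · have := (hline M).const_mul (fr r x)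
      convert! this using 1
      rw [hM]; field_simp; ring
    · simp [hfz]
  have e3 : ∀ᶠ p in 𝓝 (r, x), 0 < fr p.1 p.2 * fx p.1 p.2 :=
    (hfr.mul hfx).continuousAt.eventually (lt_mem_nhds hpos)
  obtain ⟨δ, hδ, hball⟩ := Metric.eventually_nhds_iff_ball.1 e3
  have e4 : ∀ᶠ h in 𝓝[>] (0 : ℝ), h < min (min δ (δ / M)) (min (r - r₀) (-x / M)) := by
    refine nhdsWithin_le_nhds (gt_mem_nhds ?_)
    have : 0 < -x := by linarith
    have : 0 < r - r₀ := by linarith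
    positivity
  obtain ⟨h, h1, h2, h3, h4⟩ := (e1.and (e2.and (e4.and self_mem_nhdsWithin))).exists
  have h4 : 0 < h := h4
  simp only [lt_min_iff] at h3
  obtain ⟨⟨h5, h6⟩, h7, h8⟩ := h3
  rw [lt_div_iff₀ hMpos] at h6 h8
  have hc : Continuous fun y => fr r x * f (r - h) y :=
    continuous_const.mul (hfc.comp (by fun_prop : Continuous fun y : ℝ => (r - h, y)))
  have hMh : 0 < M * h := by positivity
  obtain ⟨y, ⟨hy1, hy2⟩, hy⟩ := intermediate_value_Icc (show x ≤ x + M * h by linarith)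
    hc.continuousOn (show (0 : ℝ) ∈ Set.Icc _ _ from ⟨by linarith, h2.le⟩)
  have hy' : f (r - h) y = 0 := (mul_eq_zero.1 hy).resolve_left hA
  have hmem : (r - h, y) ∈ Z := by
    refine ⟨⟨⟨by linarith, by simp only; linarith⟩, by simp only; linarith, by simp only; linarith⟩, hy', ?_⟩
    refine (hball (r - h, y) ?_).le
    rw [Metric.mem_ball, Prod.dist_eq, max_lt_iff, Real.dist_eq, Real.dist_eq, abs_lt, abs_lt]
    constructor <;> constructor <;> simp only <;> linarith
  have : r ≤ r - h := hmin hmem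
  linarith

/-! ### Polynomials in two variables and their partial derivatives. -/

/-- The value of a polynomial in two variables. -/
def eval₂₂ {A : Type*} [CommRing A] [Algebra ℝ A] (a b : A) : ℝ[X][X] →+* A :=
  eval₂RingHom (aeval (R := ℝ) a : ℝ[X] →+* A) b

theorem eval₂₂_monomial {A : Type*} [CommRing A] [Algebra ℝ A] (a b : A) (i : ℕ) (p : ℝ[X]) :
    eval₂₂ a b (monomial i p) = aeval a p * b ^ i := by
  simp [eval₂₂]

theorem eval₂₂_C {A : Type*} [CommRing A] [Algebra ℝ A] (a b : A) (p : ℝ[X]) :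
    eval₂₂ a b (C p) = aeval a p := by
  simp [eval₂₂]

theorem eval₂₂_X {A : Type*} [CommRing A] [Algebra ℝ A] (a b : A) :
    eval₂₂ a b X = b := by
  simp [eval₂₂]

theorem map_eval₂₂ {A B : Type*} [CommRing A] [Algebra ℝ A] [CommRing B] [Algebra ℝ B]
    (φ : A →ₐ[ℝ] B) (a b : A) (Θ : ℝ[X][X]) : φ (eval₂₂ a b Θ) = eval₂₂ (φ a) (φ b) Θ := by
  induction Θ using Polynomial.induction_on' with
  | add p q hp hq => simp [hp, hq]
  | monomial i p => simp [eval₂₂_monomial, aeval_algHom_apply]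

theorem eval₂₂_comp {A : Type*} [CommRing A] [Algebra ℝ A] (a b : A) (P W : ℝ[X][X]) :
    eval₂₂ a b (P.comp W) = eval₂₂ a (eval₂₂ a b W) P := by
  induction P using Polynomial.induction_on' with
  | add p q hp hq => simp [hp, hq]
  | monomial i p => simp [eval₂₂_monomial, monomial_comp, eval₂₂_C]

theorem eval₂₂_zero_right {A : Type*} [CommRing A] [Algebra ℝ A] (a : A) (P : ℝ[X][X]) :
    eval₂₂ a 0 P = aeval a (P.coeff 0) := by
  induction P using Polynomial.induction_on' with
  | add p q hp hq => simp [hp, hq]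
  | monomial i p =>
    rw [eval₂₂_monomial, coeff_monomial]
    by_cases hi : i = 0 <;> simp [hi]

/-- The partial derivative with respect to the inner variable. -/
def innerDerivative (Θ : ℝ[X][X]) : ℝ[X][X] := Θ.sum fun i a => monomial i (derivative a)

theorem innerDerivative_add (p q : ℝ[X][X]) :
    innerDerivative (p + q) = innerDerivative p + innerDerivative q :=
  sum_add_index _ _ _ (by simp) (by simp)

theorem innerDerivative_monomial (i : ℕ) (a : ℝ[X]) :
    innerDerivative (monomial i a) = monomial i (derivative a) :=
  sum_monomial_index _ _ (by simp)

theorem hasFDerivAt_eval₂₂ (Θ : ℝ[X][X]) (r x : ℝ) :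
    HasFDerivAt (fun p : ℝ × ℝ => eval₂₂ p.1 p.2 Θ)
      (eval₂₂ r x (innerDerivative Θ) • ContinuousLinearMap.fst ℝ ℝ ℝ +
        eval₂₂ r x (derivative Θ) • ContinuousLinearMap.snd ℝ ℝ ℝ) (r, x) := by
  induction Θ using Polynomial.induction_on' with
  | add p q hp hq =>
    simp only [map_add, innerDerivative_add]
    convert! hp.add hq using 1
    module
  | monomial i a =>
    simp only [eval₂₂_monomial, innerDerivative_monomial, derivative_monomial]
    have h1 : HasFDerivAt (fun p : ℝ × ℝ => aeval p.1 a)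
        (aeval r (derivative a) • ContinuousLinearMap.fst ℝ ℝ ℝ) (r, x) :=
      HasDerivAt.comp_hasFDerivAt (f := (Prod.fst : ℝ × ℝ → ℝ)) (r, x) (a.hasDerivAt_aeval r)
        hasFDerivAt_fst
    have h2 : HasFDerivAt (fun p : ℝ × ℝ => p.2 ^ i)
        ((i * x ^ (i - 1)) • ContinuousLinearMap.snd ℝ ℝ ℝ) (r, x) :=
      HasDerivAt.comp_hasFDerivAt (f := (Prod.snd : ℝ × ℝ → ℝ)) (r, x) (hasDerivAt_pow i x)
        hasFDerivAt_snd
    convert! h1.mul h2 using 1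
    simp only [map_mul, map_natCast]
    module

theorem derivation_eval₂₂ {A : Type*} [CommRing A] [Algebra ℝ A] (D : Derivation ℝ A A) (a b : A)
    (Θ : ℝ[X][X]) : D (eval₂₂ a b Θ) =
      eval₂₂ a b (innerDerivative Θ) * D a + eval₂₂ a b (derivative Θ) * D b := by
  induction Θ using Polynomial.induction_on' with
  | add p q hp hq => simp only [map_add, innerDerivative_add, hp, hq]; ring
  | monomial i p =>
    simp only [eval₂₂_monomial, innerDerivative_monomial, derivative_monomial, Derivation.leibniz,
      Derivation.leibniz_pow, Derivation.map_aeval, smul_eq_mul, nsmul_eq_mul, map_mul, map_natCast]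
    ring

end TameAtInfinity
end

/-! ### Algebraic functions of an infinite hyperreal. -/

noncomputable section

open Polynomial IntermediateField Topology Filter

namespace TameAtInfinity

/-- A hyperreal number larger than all reals. -/
def IsPosInfinite (t : ℝ*) : Prop := ∀ r : ℝ, algebraMap ℝ ℝ* r < t

theorem IsPosInfinite.transcendental {t : ℝ*} (ht : IsPosInfinite t) : Transcendental ℝ t := by
  rintro ⟨p, hp, hpt⟩
  obtain ⟨τ, rfl⟩ := seqHom_surjective t
  obtain ⟨b, hb⟩ := (p.rootSet_finite ℝ).bddAbove
  have h1 := ht b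
  rw [algebraMap_eq_seqHom, seqHom_lt] at h1
  let φ : (ℕ → ℝ) →ₐ[ℝ] ℝ* := { seqHom with commutes' := fun _ => rfl }
  have h2 : seqHom (aeval τ p) = seqHom 0 := by
    rw [map_zero, ← hpt]
    exact (aeval_algHom_apply φ τ p).symm
  rw [seqHom_eq] at h2
  obtain ⟨n, hn1, hn2⟩ := (h1.and h2).exists
  have h3 : aeval (τ n) p = 0 := by
    refine Eq.trans ?_ hn2
    exact aeval_algHom_apply (Pi.evalAlgHom ℝ (fun _ : ℕ => ℝ) n) τ p
  exact absurd (hb ((mem_rootSet).2 ⟨hp, h3⟩)) (not_le.2 hn1)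

/-- `P` is an annihilating polynomial of `z` over `ℝ[t]` of least degree. -/
structure IsMinimalRelation (t z : ℝ*) (P : ℝ[X][X]) : Prop where
  ne_zero : P ≠ 0
  eval_eq_zero : eval₂₂ t z P = 0
  natDegree_le : ∀ P', P' ≠ 0 → eval₂₂ t z P' = 0 → P.natDegree ≤ P'.natDegree

theorem exists_isMinimalRelation {t z : ℝ*} (hz : IsAlgebraic ℝ⟮t⟯ z) :
    ∃ P, IsMinimalRelation t z P := by
  have h1 := isAlgebraic_adjoin_iff.1 hz
  obtain ⟨p, hp0, hp⟩ := h1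
  let π : ℝ[X] →+* Algebra.adjoin ℝ {t} :=
    (aeval (⟨t, Algebra.self_mem_adjoin_singleton ℝ t⟩ : Algebra.adjoin ℝ {t})).toRingHom
  have hπ : ∀ a, (π a : ℝ*) = aeval t a := fun a =>
    (aeval_algHom_apply (Algebra.adjoin ℝ {t}).val _ a).symm
  have hπs : Function.Surjective π := by
    rintro ⟨x, hx⟩
    have hx' := hx
    rw [Algebra.adjoin_singleton_eq_range_aeval] at hx'
    obtain ⟨a, ha⟩ := hx'
    exact ⟨a, Subtype.ext ((hπ a).trans ha)⟩
  obtain ⟨P, rfl⟩ := Polynomial.map_surjective π hπs p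
  have hP : P ≠ 0 ∧ eval₂₂ t z P = 0 := by
    refine ⟨fun h => hp0 (by rw [h, Polynomial.map_zero]), ?_⟩
    rw [← hp, aeval_def, eval₂_map]
    change eval₂ _ _ _ = _
    congr 1
    ext a
    · exact (hπ _).symm
    · exact (hπ _).symm
  classical
  have hex : ∃ n, ∃ P : ℝ[X][X], P.natDegree = n ∧ P ≠ 0 ∧ eval₂₂ t z P = 0 := ⟨_, P, rfl, hP⟩
  obtain ⟨P', hd, h0, h1⟩ := Nat.find_spec hex
  exact ⟨P', h0, h1, fun P'' h0'' h1'' => hd ▸ Nat.find_min' hex ⟨P'', rfl, h0'', h1''⟩⟩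

theorem IsMinimalRelation.coeff_zero_ne_zero {t z : ℝ*} {P : ℝ[X][X]}
    (hP : IsMinimalRelation t z P) (hz : z ≠ 0) : P.coeff 0 ≠ 0 := by
  intro h
  obtain ⟨P₁, rfl⟩ := X_dvd_iff.2 h
  have h0 : P₁ ≠ 0 := fun h => hP.ne_zero (by rw [h, mul_zero])
  have h1 := hP.eval_eq_zero
  rw [map_mul, eval₂₂_X] at h1
  have h2 := hP.natDegree_le P₁ h0 ((mul_eq_zero.1 h1).resolve_left hz)
  rw [natDegree_X_mul h0] at h2
  omega

/-- Pseudo-division by `P`: each step lowers the degree of `V` and can be undone at `r`, where the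
leading coefficient of `P` does not vanish. Minimality leaves no nonzero remainder. -/
theorem IsMinimalRelation.eval_eq_zero_of_root {t z : ℝ*} {P V : ℝ[X][X]}
    (hP : IsMinimalRelation t z P) (hV : eval₂₂ t z V = 0) {r x : ℝ}
    (hr : aeval r P.leadingCoeff ≠ 0) (hrx : eval₂₂ r x P = 0) : eval₂₂ r x V = 0 := by
  induction hn : V.degree using WellFoundedLT.induction generalizing V with
  | ind n ih =>
    by_cases hV0 : V = 0
    · simp [hV0]
    have hle := hP.natDegree_le V hV0 hV
    have hP0 := hP.ne_zero
    have hl0 : P.leadingCoeff ≠ 0 := leadingCoeff_ne_zero.2 hP0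
    have hlV : V.leadingCoeff ≠ 0 := leadingCoeff_ne_zero.2 hV0
    have d1 : (C P.leadingCoeff * V).degree = V.degree := degree_C_mul hl0
    have hlt : (C P.leadingCoeff * V -
        C V.leadingCoeff * X ^ (V.natDegree - P.natDegree) * P).degree < V.degree := by
      rw [← d1]
      refine degree_sub_lt_left ?_ (mul_ne_zero (C_ne_zero.2 hl0) hV0) ?_
      · rw [d1, degree_mul, degree_mul, degree_C hlV, degree_X_pow, zero_add,
          degree_eq_natDegree hV0, degree_eq_natDegree hP0, ← Nat.cast_add,
          Nat.sub_add_cancel hle]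
      · rw [leadingCoeff_mul, leadingCoeff_mul, leadingCoeff_mul, leadingCoeff_C, leadingCoeff_C,
          leadingCoeff_X_pow, mul_one, mul_comm]
    have h1 := ih _ (hn ▸ hlt) (V := C P.leadingCoeff * V -
        C V.leadingCoeff * X ^ (V.natDegree - P.natDegree) * P)
      (by rw [map_sub, map_mul, map_mul, hV, hP.eval_eq_zero]; ring) rfl
    rw [map_sub, map_mul, map_mul, hrx, mul_zero, sub_zero, eval₂₂_C] at h1
    exact (mul_eq_zero.1 h1).resolve_left hr

theorem isAlgebraic_eval₂₂ {t z : ℝ*} (hz : IsAlgebraic ℝ⟮t⟯ z) (W : ℝ[X][X]) :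
    IsAlgebraic ℝ⟮t⟯ (eval₂₂ t z W) := by
  have ht : IsAlgebraic ℝ⟮t⟯ t := isAlgebraic_algebraMap (AdjoinSimple.gen ℝ t)
  induction W using Polynomial.induction_on' with
  | add p q hp hq => rw [map_add]; exact hp.add hq
  | monomial i p =>
    rw [eval₂₂_monomial]
    refine IsAlgebraic.mul ?_ (hz.pow i)
    induction p using Polynomial.induction_on' with
    | add p q hp hq => rw [map_add]; exact hp.add hq
    | monomial i c =>
      rw [aeval_monomial]
      exact (isAlgebraic_algebraMap (algebraMap ℝ ℝ⟮t⟯ c)).mul (ht.pow i)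

/-- With `R` a minimal relation of the value of `W`, the composite of `R` with `W` vanishes at `(t,
z)`, hence at the curve points allowed. A zero of `W` there is a zero of the constant term of `R`.
-/
theorem IsMinimalRelation.exists_ne_zero {t z : ℝ*} {P W : ℝ[X][X]}
    (hP : IsMinimalRelation t z P) (hz : IsAlgebraic ℝ⟮t⟯ z) (hW : eval₂₂ t z W ≠ 0) :
    ∃ h : ℝ[X], h ≠ 0 ∧ ∀ r x : ℝ, aeval r P.leadingCoeff ≠ 0 → aeval r h ≠ 0 →
      eval₂₂ r x P = 0 → eval₂₂ r x W ≠ 0 := by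
  obtain ⟨R, hR⟩ := exists_isMinimalRelation (isAlgebraic_eval₂₂ hz W)
  refine ⟨R.coeff 0, hR.coeff_zero_ne_zero hW, fun r x hr hh hrx h0 => hh ?_⟩
  have h1 : eval₂₂ t z (R.comp W) = 0 := by rw [eval₂₂_comp, hR.eval_eq_zero]
  have h2 := hP.eval_eq_zero_of_root h1 hr hrx
  rwa [eval₂₂_comp, h0, eval₂₂_zero_right] at h2

theorem exists_forall_ge_aeval_ne_zero {p : ℝ[X]} (hp : p ≠ 0) :
    ∃ b : ℝ, ∀ r, b ≤ r → aeval r p ≠ 0 := by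
  obtain ⟨b, hb⟩ := (p.rootSet_finite ℝ).bddAbove
  refine ⟨b + 1, fun r hr h => ?_⟩
  have := hb (mem_rootSet.2 ⟨hp, h⟩)
  linarith

/-- A negative infinitesimal algebraic function of `t` does not decrease. -/
theorem derivation_nonneg_of_infinitesimal {t q : ℝ*} (ht : IsPosInfinite t)
    (hq : IsAlgebraic ℝ⟮t⟯ q) (hneg : q < 0) (hinf : ∀ ε : ℝ, 0 < ε → algebraMap ℝ ℝ* (-ε) < q)
    (D : Derivation ℝ ℝ* ℝ*) (hD : D t = 1) : 0 ≤ D q := by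
  by_contra! hDq
  obtain ⟨P, hP⟩ := exists_isMinimalRelation hq
  have htr := ht.transcendental
  have hx : eval₂₂ t q (derivative P) ≠ 0 := by
    intro h
    have hd : P.natDegree ≠ 0 := by
      intro hd
      obtain ⟨c, rfl⟩ := natDegree_eq_zero.1 hd
      have h1 := hP.eval_eq_zero
      rw [eval₂₂_C] at h1
      exact hP.ne_zero (by rw [(transcendental_iff.1 htr) c h1, C_0])
    have h0 : derivative P ≠ 0 := fun h0 => hd (derivative_eq_zero.1 h0)
    exact absurd (hP.natDegree_le _ h0 h) (not_le.2 (natDegree_derivative_lt hd))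
  -- Differentiating `P(t, q) = 0` gives `P_r + P_x · D q = 0`, so `D q < 0` makes `P_r · P_x`
  -- positive: the curve descends.
  have hrel := derivation_eval₂₂ D t q P
  rw [hP.eval_eq_zero, map_zero, hD, mul_one] at hrel
  have hrel' : eval₂₂ t q (innerDerivative P) = -(eval₂₂ t q (derivative P) * D q) := by
    linear_combination -hrel
  have hprod : 0 < eval₂₂ t q (innerDerivative P * derivative P) := by
    rw [map_mul, hrel']
    have := mul_pos (mul_self_pos.2 hx) (neg_pos.2 hDq)
    linarith
  obtain ⟨h, h0, hreg⟩ := hP.exists_ne_zero hq hprod.ne'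
  -- For `r ≥ b` both partial derivatives are nonzero on the curve, and the curve misses the axis `x
  -- = 0`.
  obtain ⟨b, hb⟩ := exists_forall_ge_aeval_ne_zero
    (mul_ne_zero (mul_ne_zero h0 (leadingCoeff_ne_zero.2 hP.ne_zero))
      (hP.coeff_zero_ne_zero hneg.ne))
  simp only [map_mul, mul_ne_zero_iff] at hb
  have hcont : Continuous fun x : ℝ => eval₂₂ b x P :=
    (continuous_iff_continuousAt.2 fun p : ℝ × ℝ =>
      (hasFDerivAt_eval₂₂ P p.1 p.2).continuousAt).comp
      (by fun_prop : Continuous fun x : ℝ => (b, x))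
  have hb0 : eval₂₂ b 0 P ≠ 0 := by
    rw [eval₂₂_zero_right]; exact (hb b le_rfl).2
  obtain ⟨ε, hε, hball⟩ := Metric.eventually_nhds_iff_ball.1
    (hcont.continuousAt.eventually_ne hb0)
  obtain ⟨τ, rfl⟩ := seqHom_surjective t
  obtain ⟨κ, rfl⟩ := seqHom_surjective q
  let φ : (ℕ → ℝ) →ₐ[ℝ] ℝ* := { seqHom with commutes' := fun _ => rfl }
  have hφ : ∀ W, eval₂₂ (seqHom τ) (seqHom κ) W = seqHom fun n => eval₂₂ (τ n) (κ n) W := by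
    intro W
    have h1 := map_eval₂₂ φ τ κ W
    refine h1.symm.trans ?_
    change seqHom _ = seqHom _
    congr 1
    funext n
    exact map_eval₂₂ (Pi.evalAlgHom ℝ (fun _ : ℕ => ℝ) n) τ κ W
  have e1 := ht b
  have e2 := hinf ε hε
  have e3 := hP.eval_eq_zero
  rw [algebraMap_eq_seqHom, seqHom_lt] at e1 e2
  rw [hφ, ← map_zero seqHom, seqHom_eq] at e3
  rw [hφ, ← map_zero seqHom, seqHom_lt] at hprod
  rw [← map_zero seqHom, seqHom_lt] at hneg
  -- At this index there is a real curve point with `r > b`, `-ε < x < 0` and negative slope.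
  -- Following the curve left to `r = b`, `x` rises without crossing `0`, giving a root of `P(b, ·)`
  -- within `ε` of `0`, where none exists.
  obtain ⟨n, h1, h2, h3, h4, h5⟩ := (e1.and (e2.and (e3.and (hprod.and hneg)))).exists
  simp only [map_mul, Pi.zero_apply] at h3 h4 h5
  have hc : ∀ W, Continuous fun p : ℝ × ℝ => eval₂₂ p.1 p.2 W := fun W =>
    continuous_iff_continuousAt.2 fun p => (hasFDerivAt_eval₂₂ W p.1 p.2).continuousAt
  obtain ⟨x, hx1, hx2, hx3⟩ := exists_zero_of_neg_slope (f := fun r x => eval₂₂ r x P)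
    (hasFDerivAt_eval₂₂ P) (hc _) (hc _) h1.le h5.le
    (fun r hr => by rw [eval₂₂_zero_right]; exact (hb r hr).2)
    (fun r x hr h => by
      have := hreg r x (hb r hr).1.2 (hb r hr).1.1 h
      rwa [map_mul, mul_ne_zero_iff] at this) h3 h4.le
  refine hball x ?_ hx3
  rw [Metric.mem_ball, Real.dist_eq, sub_zero, abs_lt]
  constructor <;> linarith

/-- If `D u ≥ δ`, then `f = u - (δ/2)t` lies below every real although `D f > 0`. Its inverse is a
negative infinitesimal with negative derivative, contrary to `derivation_nonneg_of_infinitesimal`.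
-/
theorem derivation_lt_of_bounded {t u : ℝ*} (ht : IsPosInfinite t)
    (hu : IsAlgebraic ℝ⟮t⟯ u) {B : ℝ} (hB : u ≤ algebraMap ℝ ℝ* B)
    (D : Derivation ℝ ℝ* ℝ*) (hD : D t = 1) {δ : ℝ} (hδ : 0 < δ) : D u < algebraMap ℝ ℝ* δ := by
  by_contra! h
  have hmono : ∀ {a b : ℝ}, a < b → algebraMap ℝ ℝ* a < algebraMap ℝ ℝ* b := fun {a b} hab => by
    rw [algebraMap_eq_seqHom, algebraMap_eq_seqHom, seqHom_lt]
    exact Eventually.of_forall fun _ => hab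
  set d := algebraMap ℝ ℝ* (δ / 2) with hd
  have hd0 : 0 < d := by
    have := hmono (half_pos hδ)
    rwa [map_zero] at this
  have hf : ∀ r : ℝ, u - d * t < algebraMap ℝ ℝ* r := by
    intro r
    have h1 := mul_lt_mul_of_pos_left (ht ((B - r) / (δ / 2))) hd0
    rw [hd, ← map_mul, mul_div_cancel₀ _ (half_pos hδ).ne', map_sub] at h1
    rw [← hd] at h1
    linarith
  set f := u - d * t with hfdef
  have hf0 : f < 0 := by simpa using hf 0
  have hft : IsAlgebraic ℝ⟮t⟯ f :=
    hu.sub ((isAlgebraic_algebraMap (algebraMap ℝ ℝ⟮t⟯ (δ / 2))).mul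
      (isAlgebraic_algebraMap (AdjoinSimple.gen ℝ t)))
  have hDf : 0 < D f := by
    have h1 : D f = D u - d := by
      rw [hfdef, map_sub, Derivation.leibniz, hD, hd, Derivation.map_algebraMap]
      simp
    have h2 : d < algebraMap ℝ ℝ* δ := hmono (by linarith)
    rw [h1]; linarith
  have h1 := derivation_nonneg_of_infinitesimal ht hft.inv (inv_lt_zero.2 hf0) (fun ε hε => by
    have h2 := hf (-ε)⁻¹
    rw [map_inv₀] at h2
    have h3 : algebraMap ℝ ℝ* (-ε) < 0 := by simpa using hmono (neg_lt_zero.2 hε)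
    exact (lt_inv_of_neg h3 hf0).2 h2) D hD
  rw [Derivation.leibniz_inv, smul_eq_mul] at h1
  have h2 : 0 < (f⁻¹ ^ 2) * D f := mul_pos (sq_pos_of_neg (inv_lt_zero.2 hf0)) hDf
  linarith

end TameAtInfinity
end

/-! ### A tangent vector far out on a real algebraic set. -/

noncomputable section

open IntermediateField Topology Filter

namespace TameAtInfinity

theorem derivation_aeval {σ A : Type*} [Fintype σ] [CommRing A] [Algebra ℝ A]
    (D : Derivation ℝ A A) (x : σ → A) (p : MvPolynomial σ ℝ) :
    D (MvPolynomial.aeval x p) =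
      ∑ j, MvPolynomial.aeval x (MvPolynomial.pderiv j p) * D (x j) := by
  classical
  induction p using MvPolynomial.induction_on with
  | C a => simp
  | add p q hp hq => simp [hp, hq, add_mul, Finset.sum_add_distrib]
  | mul_X p i hp =>
    simp only [map_mul, MvPolynomial.aeval_X, Derivation.leibniz, smul_eq_mul, hp, map_add,
      MvPolynomial.pderiv_X, add_mul, Finset.sum_add_distrib, Finset.mul_sum, Pi.single_apply]
    simp [mul_comm, mul_left_comm]

theorem aeval_seqHom {σ : Type*} (f : σ → ℕ → ℝ) (p : MvPolynomial σ ℝ) :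
    MvPolynomial.aeval (fun j => seqHom (f j)) p =
      seqHom fun n => MvPolynomial.eval (fun j => f j n) p := by
  induction p using MvPolynomial.induction_on with
  | C a => rw [MvPolynomial.aeval_C, algebraMap_eq_seqHom]; simp
  | add p q hp hq => rw [map_add, hp, hq, ← map_add]; congr 1; funext n; simp
  | mul_X p i hp =>
    rw [map_mul, hp, MvPolynomial.aeval_X, ← map_mul]; congr 1; funext n; simp

/-- An infinitesimal form of the curve selection lemma at infinity: if the coordinate `a` is
unbounded on a real algebraic set, there are points far away with a tangent vector along
which `a` moves with speed one and bounded coordinates move slowly. -/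
theorem exists_tangent_vector {σ ι : Type*} [Fintype σ] [Fintype ι] (F : ι → MvPolynomial σ ℝ)
    (a : σ) (s : Set σ) (B : ℝ)
    (hunb : ∀ n : ℕ, ∃ x : σ → ℝ, (∀ i, MvPolynomial.eval x (F i) = 0) ∧ n < x a)
    (hbd : ∀ x : σ → ℝ, (∀ i, MvPolynomial.eval x (F i) = 0) → ∀ j ∈ s, |x j| ≤ B)
    {δ : ℝ} (hδ : 0 < δ) (R : ℝ) :
    ∃ x v : σ → ℝ, (∀ i, MvPolynomial.eval x (F i) = 0) ∧
      (∀ i, ∑ j, MvPolynomial.eval x (MvPolynomial.pderiv j (F i)) * v j = 0) ∧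
      R < x a ∧ v a = 1 ∧ ∀ j ∈ s, |v j| < δ := by
  choose z hz hza using hunb
  set t := seqHom fun n => z n a with ht_def
  have ht : IsPosInfinite t := by
    intro r
    rw [algebraMap_eq_seqHom, ht_def, seqHom_lt]
    have h1 : ∀ᶠ n : ℕ in atTop, r < n := tendsto_natCast_atTop_atTop.eventually_gt_atTop r
    filter_upwards [Nat.hyperfilter_le_atTop h1] with n hn
    exact lt_trans hn (hza n)
  -- Coordinates in `k` are algebraic over `ℝ(t)`, as the estimate of derivatives requires.
  let k := algebraicClosure ℝ⟮t⟯ ℝ*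
  have hk : ∀ x : ℝ*, IsAlgebraic k x → ∃ c : k, algebraMap k ℝ* c = x := by
    intro x hx
    have : IsAlgebraic ℝ⟮t⟯ x := IsAlgebraic.restrictScalars _ hx
    exact ⟨⟨x, mem_algebraicClosure_iff.2 this⟩, rfl⟩
  have htk : t ∈ k := mem_algebraicClosure_iff.2 (isAlgebraic_algebraMap (AdjoinSimple.gen ℝ t))
  have : IsScalarTower ℝ k ℝ* := IsScalarTower.of_algebraMap_eq fun _ => rfl
  let G : MvPolynomial σ k := ∑ i, (MvPolynomial.map (algebraMap ℝ k) (F i)) ^ 2 +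
    (MvPolynomial.X a - MvPolynomial.C ⟨t, htk⟩) ^ 2
  have hG : ∀ x : σ → ℝ*, MvPolynomial.aeval x G = 0 ↔
      (∀ i, MvPolynomial.aeval x (F i) = 0) ∧ x a = t := by
    intro x
    simp only [G, map_add, map_sum, map_pow, map_sub, MvPolynomial.aeval_X, MvPolynomial.aeval_C,
      MvPolynomial.aeval_map_algebraMap]
    rw [add_eq_zero_iff_of_nonneg (Finset.sum_nonneg fun _ _ => sq_nonneg _) (sq_nonneg _),
      Finset.sum_eq_zero_iff_of_nonneg (fun _ _ => sq_nonneg _), sq_eq_zero_iff, sub_eq_zero]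
    simp only [Finset.mem_univ, true_imp_iff, sq_eq_zero_iff]
    rfl
  obtain ⟨x, hx⟩ := exists_zero_of_exists_zero_hyperreal hk G
    ⟨fun j => seqHom fun n => z n j, (hG _).2 ⟨fun i => by
      rw [aeval_seqHom, ← map_zero seqHom]
      congr 1
      funext n
      exact hz n i, rfl⟩⟩
  obtain ⟨hxF, hxa⟩ := (hG _).1 hx
  have hxalg : ∀ j, IsAlgebraic ℝ⟮t⟯ (x j : ℝ*) := fun j => mem_algebraicClosure_iff.1 (x j).2
  obtain ⟨D, hD⟩ := exists_derivation_eq_one ht.transcendental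
  choose f hf using fun j => seqHom_surjective (x j : ℝ*)
  -- The entries `D (x j)` form a tangent vector: applying `D` to the equations linearizes them.
  choose g hg using fun j => seqHom_surjective (D (x j : ℝ*))
  have hfx : (fun j => algebraMap k ℝ* (x j)) = fun j => seqHom (f j) :=
    funext fun j => (hf j).symm
  rw [hfx] at hxF
  have e1 : ∀ i, ∀ᶠ n in hyperfilter ℕ, MvPolynomial.eval (fun j => f j n) (F i) = 0 := by
    intro i
    have := hxF i
    rwa [aeval_seqHom, ← map_zero seqHom, seqHom_eq] at this
  have e2 : ∀ i, ∀ᶠ n in hyperfilter ℕ,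
      ∑ j, MvPolynomial.eval (fun j => f j n) (MvPolynomial.pderiv j (F i)) * g j n = 0 := by
    intro i
    have h1 := derivation_aeval D (fun j => seqHom (f j)) (F i)
    rw [hxF i, map_zero] at h1
    simp only [hf, ← hg] at h1
    simp only [← hf, aeval_seqHom, ← map_mul, ← map_sum] at h1
    rw [← map_zero seqHom, seqHom_eq] at h1
    filter_upwards [h1] with n hn
    simpa using hn.symm
  have hxa' : seqHom (f a) = t := (hf a).trans hxa
  have e3 : ∀ᶠ n in hyperfilter ℕ, R < f a n := by
    have := ht R
    rwa [← hxa', algebraMap_eq_seqHom, seqHom_lt] at this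
  have e4 : ∀ᶠ n in hyperfilter ℕ, g a n = 1 := by
    have h1 : seqHom (g a) = seqHom 1 := by
      rw [hg, map_one, ← hf, hxa', hD]
    rwa [seqHom_eq] at h1
  have e5 : ∀ j, ∀ᶠ n in hyperfilter ℕ, j ∈ s → |g j n| < δ := by
    intro j
    by_cases hj : j ∈ s
    · have hb : ∀ᶠ n in hyperfilter ℕ, |f j n| ≤ B := by
        filter_upwards [eventually_all.2 e1] with n hn
        exact hbd _ hn j hj
      have hu : seqHom (f j) ≤ algebraMap ℝ ℝ* B := by
        rw [algebraMap_eq_seqHom, seqHom_le]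
        filter_upwards [hb] with n hn using (abs_le.1 hn).2
      have hu' : -seqHom (f j) ≤ algebraMap ℝ ℝ* B := by
        rw [algebraMap_eq_seqHom, ← map_neg, seqHom_le]
        filter_upwards [hb] with n hn
        have := (abs_le.1 hn).1
        simp only [Pi.neg_apply]
        linarith
      rw [hf] at hu hu'
      have h1 := derivation_lt_of_bounded ht (hxalg j) hu D hD hδ
      have h2 := derivation_lt_of_bounded ht (hxalg j).neg hu' D hD hδ
      rw [map_neg] at h2
      rw [← hg, algebraMap_eq_seqHom, seqHom_lt] at h1
      rw [← hg, ← map_neg, algebraMap_eq_seqHom, seqHom_lt] at h2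
      filter_upwards [h1, h2] with n h1 h2 _
      simp only [Pi.neg_apply] at h2
      exact abs_lt.2 ⟨by linarith, h1⟩
    · exact Eventually.of_forall fun n h => absurd h hj
  obtain ⟨n, h1, h2, h3, h4, h5⟩ := ((eventually_all.2 e1).and ((eventually_all.2 e2).and
    (e3.and (e4.and (eventually_all.2 e5))))).exists
  exact ⟨fun j => f j n, fun j => g j n, h1, h2, h3, h4, h5⟩

end TameAtInfinity
end

/-! ### Complex unknowns as pairs of real ones. -/

noncomputable section

open IntermediateField Topology Filter

namespace TameAtInfinity

theorem hasFDerivAt_mvPolynomial_eval {σ 𝕜 : Type*} [Fintype σ] [NontriviallyNormedField 𝕜]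
    (p : MvPolynomial σ 𝕜) (x : σ → 𝕜) :
    HasFDerivAt (fun y : σ → 𝕜 => MvPolynomial.eval y p)
      (∑ j, MvPolynomial.eval x (MvPolynomial.pderiv j p) •
        (ContinuousLinearMap.proj j : (σ → 𝕜) →L[𝕜] 𝕜)) x := by
  classical
  induction p using MvPolynomial.induction_on with
  | C a =>
    simp only [MvPolynomial.eval_C]
    refine (hasFDerivAt_const a x).congr_fderiv ?_
    ext v
    simp
  | add p q hp hq =>
    simp only [map_add]
    refine (hp.add hq).congr_fderiv ?_
    ext v
    simp [add_mul, Finset.sum_add_distrib]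
  | mul_X p i hp =>
    simp only [map_mul, MvPolynomial.eval_X]
    refine (hp.mul (hasFDerivAt_apply i x)).congr_fderiv ?_
    ext v
    simp [apply_ite, Derivation.leibniz, MvPolynomial.pderiv_X, Pi.single_apply, add_mul, Finset.sum_add_distrib,
      Finset.mul_sum, mul_assoc]

theorem hasDerivAt_mvPolynomial_eval_line {σ 𝕜 : Type*} [Fintype σ] [NontriviallyNormedField 𝕜]
    (p : MvPolynomial σ 𝕜) (x v : σ → 𝕜) :
    HasDerivAt (fun s : 𝕜 => MvPolynomial.eval (fun j => x j + s * v j) p)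
      (∑ j, MvPolynomial.eval x (MvPolynomial.pderiv j p) * v j) 0 := by
  have hγ : HasDerivAt (fun s : 𝕜 => fun j => x j + s * v j) v 0 := by
    rw [hasDerivAt_pi]
    intro j
    simpa using ((hasDerivAt_id (0 : 𝕜)).mul_const (v j)).const_add (x j)
  have h1 := hasFDerivAt_mvPolynomial_eval p x
  have h2 : x = (fun s : 𝕜 => fun j => x j + s * v j) 0 := by simp
  rw [h2] at h1
  convert! h1.comp_hasDerivAt 0 hγ using 1
  simp

variable {τ : Type*}

/-- The point of `ℂ^τ` with given real and imaginary parts of the coordinates. -/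
def toComplex (x : τ × Bool → ℝ) : τ → ℂ := fun j => ⟨x (j, false), x (j, true)⟩

/-- The real and imaginary parts of the coordinates. -/
def ofComplex (ζ : τ → ℂ) : τ × Bool → ℝ := fun j => if j.2 then (ζ j.1).im else (ζ j.1).re

theorem toComplex_ofComplex (ζ : τ → ℂ) : toComplex (ofComplex ζ) = ζ := by
  funext j
  simp [toComplex, ofComplex]

/-- Real polynomials in the real and imaginary parts of the coordinates. -/
def IsRealPoly (W : (τ → ℂ) → ℝ) : Prop :=
  ∃ p : MvPolynomial (τ × Bool) ℝ, ∀ x, W (toComplex x) = MvPolynomial.eval x p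

theorem IsRealPoly.add {V W : (τ → ℂ) → ℝ} (hV : IsRealPoly V) (hW : IsRealPoly W) :
    IsRealPoly fun ζ => V ζ + W ζ := by
  obtain ⟨p, hp⟩ := hV
  obtain ⟨q, hq⟩ := hW
  exact ⟨p + q, fun x => by simp [hp, hq]⟩

theorem IsRealPoly.mul {V W : (τ → ℂ) → ℝ} (hV : IsRealPoly V) (hW : IsRealPoly W) :
    IsRealPoly fun ζ => V ζ * W ζ := by
  obtain ⟨p, hp⟩ := hV
  obtain ⟨q, hq⟩ := hW
  exact ⟨p * q, fun x => by simp [hp, hq]⟩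

theorem IsRealPoly.neg {V : (τ → ℂ) → ℝ} (hV : IsRealPoly V) : IsRealPoly fun ζ => -V ζ := by
  obtain ⟨p, hp⟩ := hV
  exact ⟨-p, fun x => by simp [hp]⟩

theorem isRealPoly_const (c : ℝ) : IsRealPoly fun _ : τ → ℂ => c :=
  ⟨MvPolynomial.C c, fun x => by simp⟩

theorem isRealPoly_re (j : τ) : IsRealPoly fun ζ : τ → ℂ => (ζ j).re :=
  ⟨MvPolynomial.X (j, false), fun x => by simp [toComplex]⟩

theorem isRealPoly_im (j : τ) : IsRealPoly fun ζ : τ → ℂ => (ζ j).im :=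
  ⟨MvPolynomial.X (j, true), fun x => by simp [toComplex]⟩

/-- Complex polynomials in the coordinates and their conjugates. -/
def IsPolyFun (W : (τ → ℂ) → ℂ) : Prop :=
  IsRealPoly (fun ζ => (W ζ).re) ∧ IsRealPoly fun ζ => (W ζ).im

theorem isPolyFun_const (c : ℂ) : IsPolyFun fun _ : τ → ℂ => c :=
  ⟨isRealPoly_const _, isRealPoly_const _⟩

theorem isPolyFun_coord (j : τ) : IsPolyFun fun ζ : τ → ℂ => ζ j :=
  ⟨isRealPoly_re j, isRealPoly_im j⟩

theorem isPolyFun_conj_coord (j : τ) : IsPolyFun fun ζ : τ → ℂ => (starRingEnd ℂ) (ζ j) :=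
  ⟨by simpa using isRealPoly_re j, by simpa using (isRealPoly_im j).neg⟩

theorem IsPolyFun.add {V W : (τ → ℂ) → ℂ} (hV : IsPolyFun V) (hW : IsPolyFun W) :
    IsPolyFun fun ζ => V ζ + W ζ :=
  ⟨hV.1.add hW.1, hV.2.add hW.2⟩

theorem IsPolyFun.mul {V W : (τ → ℂ) → ℂ} (hV : IsPolyFun V) (hW : IsPolyFun W) :
    IsPolyFun fun ζ => V ζ * W ζ := by
  refine ⟨?_, ?_⟩
  · simpa only [Complex.mul_re, sub_eq_add_neg] using (hV.1.mul hW.1).add (hV.2.mul hW.2).neg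
  · simpa only [Complex.mul_im] using (hV.1.mul hW.2).add (hV.2.mul hW.1)

theorem IsPolyFun.sub {V W : (τ → ℂ) → ℂ} (hV : IsPolyFun V) (hW : IsPolyFun W) :
    IsPolyFun fun ζ => V ζ - W ζ := by
  simpa [sub_eq_add_neg] using hV.add ((isPolyFun_const (-1)).mul hW)

theorem IsPolyFun.sum {ι : Type*} (s : Finset ι) {V : ι → (τ → ℂ) → ℂ}
    (hV : ∀ i ∈ s, IsPolyFun (V i)) : IsPolyFun fun ζ => ∑ i ∈ s, V i ζ := by
  classical
  induction s using Finset.induction_on with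
  | empty => simpa using isPolyFun_const 0
  | insert i s hi ih =>
    simp only [Finset.sum_insert hi]
    exact (hV i (by simp)).add (ih fun j hj => hV j (by simp [hj]))

theorem isPolyFun_eval {σ : Type*} (p : MvPolynomial σ ℂ) (f : σ → τ) :
    IsPolyFun fun ζ : τ → ℂ => MvPolynomial.eval (fun j => ζ (f j)) p := by
  induction p using MvPolynomial.induction_on with
  | C a => simpa using isPolyFun_const a
  | add p q hp hq => simpa using hp.add hq
  | mul_X p i hp => simpa using hp.mul (isPolyFun_coord (f i))

/-- Tangency is expressed through derivatives along real lines because the `W i` may involve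
conjugates. -/
theorem exists_tangent_vector_complex {ι : Type*} [Fintype τ] [Fintype ι] (W : ι → (τ → ℂ) → ℂ)
    (hW : ∀ i, IsPolyFun (W i)) (a c : τ) (B : ℝ)
    (hunb : ∀ n : ℕ, ∃ ζ : τ → ℂ, (∀ i, W i ζ = 0) ∧ n < (ζ a).re)
    (hbd : ∀ ζ : τ → ℂ, (∀ i, W i ζ = 0) → ‖ζ c‖ ≤ B) {δ : ℝ} (hδ : 0 < δ) (R : ℝ) :
    ∃ ζ v : τ → ℂ, (∀ i, W i ζ = 0) ∧
      (∀ i, HasDerivAt (fun s : ℝ => W i fun j => ζ j + s * v j) 0 0) ∧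
      R < (ζ a).re ∧ (v a).re = 1 ∧ ‖v c‖ < δ := by
  have hW' : ∀ i, ∃ p q : MvPolynomial (τ × Bool) ℝ, ∀ x,
      (W i (toComplex x)).re = MvPolynomial.eval x p ∧
      (W i (toComplex x)).im = MvPolynomial.eval x q := by
    intro i
    obtain ⟨⟨p, hp⟩, ⟨q, hq⟩⟩ := hW i
    exact ⟨p, q, fun x => ⟨hp x, hq x⟩⟩
  choose p q hpq using hW'
  have hp := fun i x => (hpq i x).1
  have hq := fun i x => (hpq i x).2
  have hzero : ∀ x, (∀ i : ι × Bool, MvPolynomial.eval x (if i.2 then q i.1 else p i.1) = 0) ↔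
      ∀ i, W i (toComplex x) = 0 := by
    intro x
    constructor
    · intro h i
      apply Complex.ext
      · rw [hp]; simpa using h (i, false)
      · rw [hq]; simpa using h (i, true)
    · rintro h ⟨i, _ | _⟩
      · simpa [h i] using (hp i x).symm
      · simpa [h i] using (hq i x).symm
  obtain ⟨x, v, h1, h2, h3, h4, h5⟩ := exists_tangent_vector
    (fun i : ι × Bool => if i.2 then q i.1 else p i.1) (a, false) {(c, false), (c, true)} B
    (fun n => by
      obtain ⟨ζ, h1, h2⟩ := hunb n
      refine ⟨ofComplex ζ, (hzero _).2 ?_, ?_⟩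
      · rw [toComplex_ofComplex]; exact h1
      · simpa [ofComplex] using h2)
    (fun x hx j hj => by
      have h := hbd _ ((hzero x).1 hx)
      rcases hj with rfl | rfl
      · exact (Complex.abs_re_le_norm (toComplex x c)).trans h
      · exact (Complex.abs_im_le_norm (toComplex x c)).trans h) (half_pos hδ) R
  refine ⟨toComplex x, toComplex v, (hzero x).1 h1, fun i => ?_, h3, h4, ?_⟩
  · have hline : ∀ s : ℝ, (fun j => toComplex x j + s * toComplex v j) =
        toComplex fun j => x j + s * v j := by
      intro s
      funext j
      apply Complex.ext <;> simp [toComplex]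
    have e1 := hasDerivAt_mvPolynomial_eval_line (p i) x v
    have e2 := hasDerivAt_mvPolynomial_eval_line (q i) x v
    have z1 := h2 (i, false)
    have z2 := h2 (i, true)
    simp only [Bool.false_eq_true, if_false, if_true] at z1 z2
    rw [z1] at e1
    rw [z2] at e2
    have e3 := e1.ofReal_comp.add (e2.ofReal_comp.mul_const Complex.I)
    simp only [Complex.ofReal_zero, zero_mul, add_zero] at e3
    refine e3.congr_of_eventuallyEq (Eventually.of_forall fun s => ?_)
    simp only [hline, Pi.add_apply, ← hp, ← hq]
    exact (Complex.re_add_im _).symm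
  · have k1 := h5 (c, false) (by simp)
    have k2 := h5 (c, true) (by simp)
    refine (Complex.norm_le_abs_re_add_abs_im _).trans_lt ?_
    simp only [toComplex]
    linarith

end TameAtInfinity
end

/-! ### Differentials on `S` and the linear algebra of `M(g)`. -/

noncomputable section

open Topology Filter

namespace TameAtInfinity

variable {N : ℕ}

/-- The complex differential of a polynomial at a point. -/
def polyDiff (p : Poly N) (z : AffSpace N) : AffSpace N →L[ℂ] ℂ :=
  ∑ j, partials p z j • EuclideanSpace.proj j

theorem polyDiff_apply (p : Poly N) (z v : AffSpace N) :
    polyDiff p z v = ∑ j, partials p z j * v j := by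
  simp [polyDiff]

theorem hasFDerivAt_value (p : Poly N) (z : AffSpace N) :
    HasFDerivAt (value p) (polyDiff p z) z := by
  have h1 := hasFDerivAt_mvPolynomial_eval p (fun j => z j)
  have h2 : HasFDerivAt (fun x : AffSpace N => fun j => x j)
      ((EuclideanSpace.equiv (Fin N) ℂ : AffSpace N →L[ℂ] Fin N → ℂ)) z :=
    (EuclideanSpace.equiv (Fin N) ℂ : AffSpace N →L[ℂ] Fin N → ℂ).hasFDerivAt
  refine (HasFDerivAt.comp z (f := fun x : AffSpace N => fun j => x j) h1 h2).congr_fderiv ?_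
  ext v
  simp [polyDiff, partials, value]

/-- The complex differential of `P / Q` at a point where `Q` does not vanish. -/
def ratDiff (P Q : Poly N) (z : AffSpace N) : AffSpace N →L[ℂ] ℂ :=
  (value Q z)⁻¹ • (polyDiff P z - ratFun P Q z • polyDiff Q z)

theorem hasFDerivAt_ratFun (P Q : Poly N) {z : AffSpace N} (hz : value Q z ≠ 0) :
    HasFDerivAt (ratFun P Q) (ratDiff P Q z) z := by
  have h1 := (hasFDerivAt_value P z).mul ((hasDerivAt_inv hz).comp_hasFDerivAt z
    (hasFDerivAt_value Q z))
  refine (h1.congr_fderiv ?_).congr_of_eventuallyEq (Eventually.of_forall fun x => ?_)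
  · ext v
    simp [ratDiff, ratFun]
    field_simp
    ring
  · simp [ratFun, div_eq_mul_inv]

theorem real_inner_eq (x y : AffSpace N) :
    inner ℝ x y = (∑ j, (starRingEnd ℂ) (x j) * y j).re := by
  simp [PiLp.inner_apply, mul_comm]

theorem diffOn_re_apply (S : Set (AffSpace N)) (P Q : Poly N) {z : AffSpace N}
    (hz : value Q z ≠ 0) (v : realTangentSpace S z) :
    diffOn S (fun x => (ratFun P Q x).re) z v = (ratDiff P Q z v).re := by
  have h := Complex.reCLM.hasFDerivAt.comp z ((hasFDerivAt_ratFun P Q hz).restrictScalars ℝ)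
  have h' : fderiv ℝ (fun x => (ratFun P Q x).re) z = _ := h.fderiv
  simp [diffOn, h']

theorem diffOn_im_apply (S : Set (AffSpace N)) (P Q : Poly N) {z : AffSpace N}
    (hz : value Q z ≠ 0) (v : realTangentSpace S z) :
    diffOn S (fun x => (ratFun P Q x).im) z v = (ratDiff P Q z v).im := by
  have h := Complex.imCLM.hasFDerivAt.comp z ((hasFDerivAt_ratFun P Q hz).restrictScalars ℝ)
  have h' : fderiv ℝ (fun x => (ratFun P Q x).im) z = _ := h.fderiv
  simp [diffOn, h']

theorem diffOn_norm_sq_apply (S : Set (AffSpace N)) (z : AffSpace N) (v : realTangentSpace S z) :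
    diffOn S (fun x => ‖x‖ ^ 2 / 2) z v = inner ℝ z (v : AffSpace N) := by
  have h := ((hasStrictFDerivAt_norm_sq z).hasFDerivAt.const_mul (1 / 2 : ℝ))
  have h' : fderiv ℝ (fun x : AffSpace N => ‖x‖ ^ 2 / 2) z = _ :=
    (h.congr_of_eventuallyEq (Eventually.of_forall fun x => by ring)).fderiv
  simp [diffOn, h']

/-- The ideal of a subset of affine space. -/
def vanishingIdeal (S : Set (AffSpace N)) : Ideal (Poly N) where
  carrier := {p | ∀ x ∈ S, value p x = 0}
  zero_mem' := by intro x _; simp [value]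
  add_mem' := by
    intro p q hp hq x hx
    have h1 := hp x hx
    have h2 := hq x hx
    simp only [value] at *
    simp [h1, h2]
  smul_mem' := by
    intro c p hp x hx
    have h1 := hp x hx
    simp only [value] at *
    simp [h1]

/-- Generators vanish at `z`, so by the product rule their differentials control those of the whole
ideal. -/
theorem mem_tangentSpace_of_generators {S : Set (AffSpace N)} {G : Finset (Poly N)}
    (hG : Ideal.span (G : Set (Poly N)) = vanishingIdeal S) {z : AffSpace N} (hz : z ∈ S)
    {v : AffSpace N} (hv : ∀ p ∈ G, polyDiff p z v = 0) : v ∈ tangentSpace S z := by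
  intro p hp
  have hp' : p ∈ Ideal.span (G : Set (Poly N)) := hG ▸ hp
  have key : value p z = 0 ∧ polyDiff p z v = 0 := by
    refine Submodule.span_induction (p := fun p _ => value p z = 0 ∧ polyDiff p z v = 0)
      ?_ ?_ ?_ ?_ hp'
    · intro p hp
      have : p ∈ vanishingIdeal S := hG ▸ Ideal.subset_span hp
      exact ⟨this z hz, hv p hp⟩
    · simp [value, polyDiff, partials]
    · rintro p q - - ⟨h1, h2⟩ ⟨h3, h4⟩
      rw [polyDiff_apply] at *
      constructor
      · simp only [value] at *; simp [h1, h3]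
      · simp only [partials, value, map_add, add_mul, Finset.sum_add_distrib] at *
        rw [h2, h4, add_zero]
    · rintro c p - ⟨h1, h2⟩
      rw [polyDiff_apply] at *
      constructor
      · simp only [value] at *; simp [h1]
      · simp only [partials, value, smul_eq_mul, Derivation.leibniz, map_add, map_mul] at *
        simp only [h1, zero_mul, add_zero, mul_assoc]
        rw [← Finset.mul_sum, h2, mul_zero]
  rw [← polyDiff_apply]
  exact key.2

theorem polyDiff_eq_zero_of_mem_tangentSpace {S : Set (AffSpace N)} {z v : AffSpace N}
    (hv : v ∈ tangentSpace S z) {p : Poly N} (hp : p ∈ vanishingIdeal S) :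
    polyDiff p z v = 0 := by
  rw [polyDiff_apply]
  exact hv p hp

/-- The conjugate of a vector as a complex linear functional. -/
def conjFunctional (z : AffSpace N) : AffSpace N →L[ℂ] ℂ :=
  ∑ j, (starRingEnd ℂ) (z j) • EuclideanSpace.proj j

theorem conjFunctional_apply (z v : AffSpace N) :
    conjFunctional z v = ∑ j, (starRingEnd ℂ) (z j) * v j := by
  simp [conjFunctional]

theorem conjFunctional_re (z v : AffSpace N) : (conjFunctional z v).re = inner ℝ z v := by
  rw [conjFunctional_apply, real_inner_eq]

/-- `a Re dg + b Im dg` is the real part of `(a - ib) dg`. The tangent space is complex, so testing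
on `i v` gives the imaginary part. -/
theorem exists_conjFunctional_eq {S : Set (AffSpace N)} {P Q : Poly N} {z : AffSpace N}
    (hz : z ∈ milnorSet S (ratFun P Q)) (hQ : value Q z ≠ 0) :
    ∃ c : ℂ, ∀ v ∈ tangentSpace S z, conjFunctional z v = c * ratDiff P Q z v := by
  obtain ⟨a, b, hab⟩ := Submodule.mem_span_pair.1 hz.2
  refine ⟨⟨a, -b⟩, ?_⟩
  have hre : ∀ v ∈ tangentSpace S z,
      (conjFunctional z v).re = ((⟨a, -b⟩ : ℂ) * ratDiff P Q z v).re := by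
    intro v hv
    have h := congrArg (fun φ => φ (⟨v, hv⟩ : realTangentSpace S z)) hab
    simp only [add_apply, smul_apply,
      diffOn_re_apply S P Q hQ, diffOn_im_apply S P Q hQ, diffOn_norm_sq_apply, smul_eq_mul] at h
    rw [conjFunctional_re, Complex.mul_re]
    simp only
    linarith
  intro v hv
  refine Complex.ext (hre v hv) ?_
  have h := hre (Complex.I • v) ((tangentSpace S z).smul_mem _ hv)
  simp only [map_smul, smul_eq_mul] at h
  rw [show ∀ w x : ℂ, w * (Complex.I * x) = Complex.I * (w * x) from fun w x => by ring] at h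
  simp only [Complex.I_mul_re] at h
  linarith

theorem exists_lagrange_multipliers {S : Set (AffSpace N)} {G : Finset (Poly N)}
    (hG : Ideal.span (G : Set (Poly N)) = vanishingIdeal S) {z : AffSpace N} (hz : z ∈ S)
    (φ : AffSpace N →L[ℂ] ℂ) (hφ : ∀ v ∈ tangentSpace S z, φ v = 0) :
    ∃ l : G → ℂ, ∀ v, φ v = ∑ p, l p * polyDiff p z v := by
  have h : ⨅ p : G, (polyDiff p.1 z).toLinearMap.ker ≤ φ.toLinearMap.ker := by
    intro v hv
    refine hφ v (mem_tangentSpace_of_generators hG hz fun p hp => ?_)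
    exact (Submodule.mem_iInf _).1 hv ⟨p, hp⟩
  obtain ⟨l, hl⟩ := (Submodule.mem_span_range_iff_exists_fun ℂ).1 (mem_span_of_iInf_ker_le_ker h)
  refine ⟨l, fun v => ?_⟩
  have := congrArg (fun ψ => ψ v) hl
  simpa using this.symm

/-- Evaluate at `c̄ w` with `w` the gradient: the real part is `|c|²‖w‖²`, and Cauchy–Schwarz
applies. -/
theorem norm_mul_norm_gradOn_le {S : Set (AffSpace N)} {P Q : Poly N} {z : AffSpace N}
    (hQ : value Q z ≠ 0) {c : ℂ}
    (hc : ∀ v ∈ tangentSpace S z, conjFunctional z v = c * ratDiff P Q z v) :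
    ‖c‖ * ‖gradOn S (fun x => (ratFun P Q x).re) z‖ ≤ ‖z‖ := by
  set w := gradOn S (fun x => (ratFun P Q x).re) z with hw
  have hinner : inner ℝ w w = (ratDiff P Q z w).re := by
    rw [← diffOn_re_apply S P Q hQ, hw, gradOn, InnerProductSpace.toDual_symm_apply]
  rw [real_inner_self_eq_norm_sq] at hinner
  have h1 := hc ((starRingEnd ℂ) c • (w : AffSpace N)) ((tangentSpace S z).smul_mem _ w.2)
  have h2 : (conjFunctional z ((starRingEnd ℂ) c • (w : AffSpace N))).re = ‖c‖ ^ 2 * ‖w‖ ^ 2 := by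
    rw [h1, map_smul, smul_eq_mul, ← mul_assoc, Complex.mul_conj, Complex.re_ofReal_mul, hinner,
      Complex.normSq_eq_norm_sq]
  rw [conjFunctional_re] at h2
  have h3 := real_inner_le_norm z ((starRingEnd ℂ) c • (w : AffSpace N))
  rw [h2, norm_smul, RCLike.norm_conj, Submodule.coe_norm] at h3
  by_contra! hlt
  have h0 : 0 < ‖c‖ * ‖w‖ := lt_of_le_of_lt (norm_nonneg _) hlt
  have h4 := mul_lt_mul_of_pos_right hlt h0
  have h5 : ‖c‖ ^ 2 * ‖(w : AffSpace N)‖ ^ 2 = ‖c‖ * ‖w‖ * (‖c‖ * ‖w‖) := by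
    rw [Submodule.coe_norm]; ring
  rw [Submodule.coe_norm] at h4 h5
  linarith

end TameAtInfinity
end

/-! ### `M(g)` as the projection of a real algebraic set. -/

noncomputable section

open Topology Filter

namespace TameAtInfinity

section System

variable {N : ℕ} (P Q : Poly N) (G B : Finset (Poly N)) (τ₀ : ℂ)

/-- Indices of the unknowns in `milnorSystem`. -/
abbrev MilnorVar (N : ℕ) (G B : Finset (Poly N)) : Type := Fin N ⊕ (G ⊕ (B ⊕ Fin 4))

/-- The point of affine space underlying a tuple of unknowns. -/
def pointOf {G B : Finset (Poly N)} (ζ : MilnorVar N G B → ℂ) : AffSpace N :=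
  WithLp.toLp 2 fun j => ζ (Sum.inl j)

/-- The Lagrange multipliers in a tuple of unknowns. -/
def multiplier {G B : Finset (Poly N)} (ζ : MilnorVar N G B → ℂ) (p : G) : ℂ :=
  ζ (Sum.inr (Sum.inl p))

/-- The unknowns certifying that some polynomial of `B` does not vanish. -/
def certificate {G B : Finset (Poly N)} (ζ : MilnorVar N G B → ℂ) (q : B) : ℂ :=
  ζ (Sum.inr (Sum.inr (Sum.inl q)))

/-- The scalar unknowns: the multiplier of `d(P/Q)` divided by `Q`, the value of `P/Q`,
the norm of the point and a slack variable. -/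
def scalar {G B : Finset (Poly N)} (ζ : MilnorVar N G B → ℂ) (m : Fin 4) : ℂ :=
  ζ (Sum.inr (Sum.inr (Sum.inr m)))

/-- The equations describing the part of the set `M(P/Q)` where `|P/Q - τ₀| ≤ 1`. -/
def milnorSystem : G ⊕ (Fin N ⊕ Fin 4) → (MilnorVar N G B → ℂ) → ℂ :=
  Sum.elim (fun p ζ => value p.1 (pointOf ζ)) <| Sum.elim
    (fun j ζ => (starRingEnd ℂ) (pointOf ζ j) -
      (scalar ζ 0 * (value (MvPolynomial.pderiv j P) (pointOf ζ) -
        scalar ζ 1 * value (MvPolynomial.pderiv j Q) (pointOf ζ)) +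
        ∑ p : G, multiplier ζ p * value (MvPolynomial.pderiv j p.1) (pointOf ζ)))
    ![fun ζ => ∑ q : B, certificate ζ q * value q.1 (pointOf ζ) - 1,
      fun ζ => scalar ζ 1 * value Q (pointOf ζ) - value P (pointOf ζ),
      fun ζ => ∑ j, (starRingEnd ℂ) (pointOf ζ j) * pointOf ζ j -
        ((scalar ζ 2).re : ℂ) * ((scalar ζ 2).re : ℂ),
      fun ζ => ((scalar ζ 1 - τ₀).re : ℂ) * ((scalar ζ 1 - τ₀).re : ℂ) +
        ((scalar ζ 1 - τ₀).im : ℂ) * ((scalar ζ 1 - τ₀).im : ℂ) +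
        ((scalar ζ 3).re : ℂ) * ((scalar ζ 3).re : ℂ) - 1]

theorem isPolyFun_milnorSystem (i : G ⊕ (Fin N ⊕ Fin 4)) :
    IsPolyFun (milnorSystem P Q G B τ₀ i) := by
  have hval : ∀ p : Poly N, IsPolyFun fun ζ : MilnorVar N G B → ℂ => value p (pointOf ζ) :=
    fun p => isPolyFun_eval p Sum.inl
  have hre : ∀ {W : (MilnorVar N G B → ℂ) → ℂ}, IsPolyFun W → IsPolyFun fun ζ => ((W ζ).re : ℂ) :=
    fun h => ⟨by simpa using h.1, by simpa using isRealPoly_const 0⟩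
  have him : ∀ {W : (MilnorVar N G B → ℂ) → ℂ}, IsPolyFun W → IsPolyFun fun ζ => ((W ζ).im : ℂ) :=
    fun h => ⟨by simpa using h.2, by simpa using isRealPoly_const 0⟩
  have hsc : ∀ m, IsPolyFun fun ζ : MilnorVar N G B → ℂ => scalar ζ m := fun m => isPolyFun_coord _
  have hτ : IsPolyFun fun ζ : MilnorVar N G B → ℂ => scalar ζ 1 - τ₀ :=
    (hsc 1).sub (isPolyFun_const τ₀)
  rcases i with p | j | m
  · exact hval p.1
  · exact (isPolyFun_conj_coord _).sub (((hsc 0).mul ((hval _).sub ((hsc 1).mul (hval _)))).add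
      (IsPolyFun.sum _ fun p _ => (isPolyFun_coord _).mul (hval _)))
  · fin_cases m
    · exact (IsPolyFun.sum _ fun q _ => (isPolyFun_coord _).mul (hval _)).sub (isPolyFun_const 1)
    · exact ((hsc 1).mul (hval _)).sub (hval _)
    · exact (IsPolyFun.sum _ fun j _ => (isPolyFun_conj_coord _).mul (isPolyFun_coord _)).sub
        ((hre (hsc 2)).mul (hre (hsc 2)))
    · exact ((((hre hτ).mul (hre hτ)).add ((him hτ).mul (him hτ))).add
        ((hre (hsc 3)).mul (hre (hsc 3)))).sub (isPolyFun_const 1)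

theorem sum_conj_mul_self (z : AffSpace N) :
    ∑ j, (starRingEnd ℂ) (z j) * z j = ((‖z‖ ^ 2 : ℝ) : ℂ) := by
  rw [EuclideanSpace.norm_sq_eq, Complex.ofReal_sum]
  exact Finset.sum_congr rfl fun j _ => by rw [Complex.conj_mul']; simp

/-- A tuple of unknowns solves the system if and only if the displayed conditions hold. -/
theorem milnorSystem_eq_zero_iff (ζ : MilnorVar N G B → ℂ) :
    (∀ i, milnorSystem P Q G B τ₀ i ζ = 0) ↔
      (∀ p ∈ G, value p (pointOf ζ) = 0) ∧
      (∀ v, conjFunctional (pointOf ζ) v =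
        scalar ζ 0 * (polyDiff P (pointOf ζ) v - scalar ζ 1 * polyDiff Q (pointOf ζ) v) +
          ∑ p : G, multiplier ζ p * polyDiff p.1 (pointOf ζ) v) ∧
      ∑ q : B, certificate ζ q * value q.1 (pointOf ζ) = 1 ∧
      scalar ζ 1 * value Q (pointOf ζ) = value P (pointOf ζ) ∧
      ‖pointOf ζ‖ ^ 2 = (scalar ζ 2).re ^ 2 ∧
      ‖scalar ζ 1 - τ₀‖ ^ 2 + (scalar ζ 3).re ^ 2 = 1 := by
  have hlin : (∀ j, milnorSystem P Q G B τ₀ (Sum.inr (Sum.inl j)) ζ = 0) ↔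
      ∀ v, conjFunctional (pointOf ζ) v =
        scalar ζ 0 * (polyDiff P (pointOf ζ) v - scalar ζ 1 * polyDiff Q (pointOf ζ) v) +
          ∑ p : G, multiplier ζ p * polyDiff p.1 (pointOf ζ) v := by
    simp only [milnorSystem, Sum.elim_inl, Sum.elim_inr, sub_eq_zero]
    constructor
    · intro h v
      simp only [conjFunctional_apply, polyDiff_apply, h, partials]
      simp only [add_mul, Finset.sum_add_distrib, Finset.sum_mul, mul_sub, sub_mul,
        Finset.sum_sub_distrib, Finset.mul_sum, mul_assoc]
      rw [Finset.sum_comm]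
    · intro h j
      have h1 := h (EuclideanSpace.single j 1)
      simpa [conjFunctional_apply, polyDiff_apply, partials] using h1
  have hfin : (∀ m, milnorSystem P Q G B τ₀ (Sum.inr (Sum.inr m)) ζ = 0) ↔
      ∑ q : B, certificate ζ q * value q.1 (pointOf ζ) = 1 ∧
      scalar ζ 1 * value Q (pointOf ζ) = value P (pointOf ζ) ∧
      ‖pointOf ζ‖ ^ 2 = (scalar ζ 2).re ^ 2 ∧
      ‖scalar ζ 1 - τ₀‖ ^ 2 + (scalar ζ 3).re ^ 2 = 1 := by
    have hnorm : ‖scalar ζ 1 - τ₀‖ ^ 2 =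
        (scalar ζ 1 - τ₀).re * (scalar ζ 1 - τ₀).re +
          (scalar ζ 1 - τ₀).im * (scalar ζ 1 - τ₀).im := by
      rw [← Complex.normSq_eq_norm_sq, Complex.normSq_apply]
    rw [Fin.forall_fin_succ, Fin.forall_fin_succ, Fin.forall_fin_succ, Fin.forall_fin_one]
    refine and_congr sub_eq_zero (and_congr sub_eq_zero (and_congr ?_ ?_))
    · change ∑ j, (starRingEnd ℂ) (pointOf ζ j) * pointOf ζ j -
        ((scalar ζ 2).re : ℂ) * ((scalar ζ 2).re : ℂ) = 0 ↔ _
      rw [sum_conj_mul_self, sub_eq_zero, ← Complex.ofReal_mul, Complex.ofReal_inj, pow_two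
        (scalar ζ 2).re]
    · change ((scalar ζ 1 - τ₀).re : ℂ) * ((scalar ζ 1 - τ₀).re : ℂ) +
        ((scalar ζ 1 - τ₀).im : ℂ) * ((scalar ζ 1 - τ₀).im : ℂ) +
        ((scalar ζ 3).re : ℂ) * ((scalar ζ 3).re : ℂ) - 1 = 0 ↔ _
      rw [hnorm, sub_eq_zero, pow_two]
      norm_cast
  rw [Sum.forall, Sum.forall, hlin, hfin]
  exact and_congr Subtype.forall Iff.rfl

end System

end TameAtInfinity

/-! ### The contradiction at infinity. -/

open TameAtInfinity in
theorem mainTheorem7 (N : ℕ) (P Q : TameAtInfinity.Poly N) (hQ : Q ≠ 0)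
    (S : Set (TameAtInfinity.AffSpace N))
    (hSU : S ⊆ {z | TameAtInfinity.value Q z ≠ 0})
    (hS : TameAtInfinity.IsQuasiAffine S)
    (hsmooth : TameAtInfinity.IsSmoothVariety S)
    (htame : TameAtInfinity.IsTameAtInfinity S (TameAtInfinity.ratFun P Q)) :
    ∀ τ₀ : ℂ, ∃ R > (0 : ℝ), ∃ ε > (0 : ℝ),
      TameAtInfinity.milnorSet S (TameAtInfinity.ratFun P Q) ∩
        {z | z ∈ S ∧ ‖TameAtInfinity.ratFun P Q z - τ₀‖ < ε ∧ ‖z‖ > R} = ∅ := by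
  intro τ₀
  by_contra! hcon
  obtain ⟨R₀, hR₀, ε₀, hε₀, htame⟩ := htame
  obtain ⟨A, B, hAB⟩ := hS
  -- Finitely many generators describe both `S`, away from the common zeros of `B`, and all its
  -- tangent spaces.
  obtain ⟨G, hG⟩ := IsNoetherian.noetherian (vanishingIdeal S)
  change Ideal.span (G : Set (Poly N)) = _ at hG
  have hmemG : ∀ p ∈ G, p ∈ vanishingIdeal S := fun p hp => hG ▸ Ideal.subset_span hp
  have hmemS : ∀ z, (∀ p ∈ G, value p z = 0) → (∃ q ∈ B, value q z ≠ 0) → z ∈ S := by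
    intro z h1 h2
    have h3 : ∀ p ∈ vanishingIdeal S, value p z = 0 := by
      intro p hp
      rw [← hG] at hp
      refine Submodule.span_induction (p := fun p _ => value p z = 0) h1 ?_ ?_ ?_ hp
      · simp [value]
      · intro p q _ _ hp hq
        simp only [value] at *; simp [hp, hq]
      · intro c p _ hp
        simp only [value] at *; simp [hp]
    rw [hAB]
    refine ⟨fun p hp => h3 p fun x hx => ?_, ?_⟩
    · rw [hAB] at hx; exact hx.1 p hp
    · simpa using h2
  have hunb : ∀ n : ℕ, ∃ ζ : MilnorVar N G B → ℂ, (∀ i, milnorSystem P Q G B τ₀ i ζ = 0) ∧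
      n < (ζ (Sum.inr (Sum.inr (Sum.inr 2)))).re := by
    intro n
    obtain ⟨z, hzM, hzS, hzτ, hzn⟩ := hcon (n + 1) (by positivity) 1 one_pos
    have hQz : value Q z ≠ 0 := hSU hzS
    obtain ⟨c, hc⟩ := exists_conjFunctional_eq hzM hQz
    obtain ⟨l, hl⟩ := exists_lagrange_multipliers hG hzS
      (conjFunctional z - c • ratDiff P Q z) (fun v hv => by simp [hc v hv])
    have hzB : ∃ q ∈ B, value q z ≠ 0 := by
      rw [hAB] at hzS
      simpa using hzS.2
    obtain ⟨q, hqB, hq⟩ := hzB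
    let ζ : MilnorVar N G B → ℂ := Sum.elim (fun j => z j) (Sum.elim l (Sum.elim
      (Pi.single ⟨q, hqB⟩ (value q z)⁻¹) ![c * (value Q z)⁻¹, ratFun P Q z, (‖z‖ : ℂ),
        (Real.sqrt (1 - ‖ratFun P Q z - τ₀‖ ^ 2) : ℂ)]))
    have e0 : pointOf ζ = z := rfl
    have e1 : scalar ζ 0 = c * (value Q z)⁻¹ := rfl
    have e2 : scalar ζ 1 = ratFun P Q z := rfl
    have e3 : scalar ζ 2 = (‖z‖ : ℂ) := rfl
    have e4 : scalar ζ 3 = (Real.sqrt (1 - ‖ratFun P Q z - τ₀‖ ^ 2) : ℂ) := rfl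
    have e5 : ∀ p, multiplier ζ p = l p := fun _ => rfl
    have e6 : ∀ q', certificate ζ q' =
      (Pi.single ⟨q, hqB⟩ (value q z)⁻¹ : B → ℂ) q' := fun _ => rfl
    refine ⟨ζ, (milnorSystem_eq_zero_iff P Q G B τ₀ ζ).2 ?_, ?_⟩
    · simp only [e0, e1, e2, e3, e4, e5, e6, Complex.ofReal_re]
      refine ⟨fun p hp => hmemG p hp z hzS, fun v => ?_, ?_, ?_, trivial, ?_⟩
      · have h := hl v
        simp only [sub_apply, smul_apply, smul_eq_mul, sub_eq_iff_eq_add] at h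
        rw [h, ratDiff]
        simp only [sub_apply, smul_apply, smul_eq_mul]
        ring
      · rw [Finset.sum_eq_single ⟨q, hqB⟩]
        · simp [hq]
        · intro q' _ h; simp [h]
        · simp
      · simp [ratFun, hQz]
      · rw [Real.sq_sqrt]
        · ring
        · have : ‖ratFun P Q z - τ₀‖ ^ 2 ≤ 1 := pow_le_one₀ (norm_nonneg _) hzτ.le
          linarith
    · change (n : ℝ) < (scalar ζ 2).re
      rw [e3, Complex.ofReal_re]
      linarith
  obtain ⟨ζ, v, h1, h2, h3, h4, h5⟩ := exists_tangent_vector_complex (milnorSystem P Q G B τ₀)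
    (isPolyFun_milnorSystem P Q G B τ₀) (Sum.inr (Sum.inr (Sum.inr 2)))
    (Sum.inr (Sum.inr (Sum.inr 1))) (‖τ₀‖ + 1) hunb (fun ζ hζ => by
      obtain ⟨-, -, -, -, -, h⟩ := (milnorSystem_eq_zero_iff P Q G B τ₀ ζ).1 hζ
      change ‖scalar ζ 1‖ ≤ _
      have h6 : ‖scalar ζ 1 - τ₀‖ ≤ 1 := by
        rw [← sq_le_one_iff₀ (norm_nonneg _)]
        nlinarith [sq_nonneg (scalar ζ 3).re]
      have h7 := norm_add_le τ₀ (scalar ζ 1 - τ₀)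
      rw [add_sub_cancel] at h7
      linarith) hε₀ R₀
  obtain ⟨k1, k2, k3, k4, k5, -⟩ := (milnorSystem_eq_zero_iff P Q G B τ₀ ζ).1 h1
  change R₀ < (scalar ζ 2).re at h3
  change (scalar v 2).re = 1 at h4
  change ‖scalar v 1‖ < ε₀ at h5
  set z := pointOf ζ with hz_def
  set w := pointOf v with hw_def
  have hzS : z ∈ S := by
    refine hmemS z k1 ?_
    by_contra! h
    rw [Finset.sum_eq_zero fun q _ => by rw [h q.1 q.2, mul_zero]] at k3
    exact zero_ne_one k3
  have hQz : value Q z ≠ 0 := hSU hzS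
  -- The system fixes only the square; positivity selects the root.
  have hnorm : ‖z‖ = (scalar ζ 2).re :=
    (sq_eq_sq₀ (norm_nonneg _) (hR₀.le.trans h3.le)).1 k5
  have hg : scalar ζ 1 = ratFun P Q z := by rw [ratFun, eq_div_iff hQz, k4]
  have hcurve : HasDerivAt (fun s : ℝ => pointOf fun j => ζ j + s * v j) w 0 := by
    have h := ((hasDerivAt_id (0 : ℝ)).smul_const w).const_add z
    rw [one_smul] at h
    refine h.congr_of_eventuallyEq (Eventually.of_forall fun s => ?_)
    ext j
    simp [hz_def, hw_def, pointOf]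
  have hγ : ∀ p : Poly N, HasDerivAt (fun s : ℝ => value p (pointOf fun j => ζ j + s * v j))
      (polyDiff p z w) 0 := by
    intro p
    have h := ((hasFDerivAt_value p z).restrictScalars ℝ)
    have h0 : z = pointOf fun j => ζ j + (0 : ℝ) * v j := by simp [hz_def]
    rw [h0] at h
    have h' := HasFDerivAt.comp_hasDerivAt (f := fun s : ℝ => pointOf fun j => ζ j + s * v j)
      0 h hcurve
    rw [← h0] at h'
    exact h'
  have d1 : ∀ p ∈ G, polyDiff p z w = 0 := fun p hp =>
    (hγ p).unique (h2 (Sum.inl ⟨p, hp⟩))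
  have hw : w ∈ tangentSpace S z := mem_tangentSpace_of_generators hG hzS d1
  have hline : ∀ j : MilnorVar N G B, HasDerivAt (fun s : ℝ => ζ j + s * v j) (v j) 0 := by
    intro j
    simpa using ((Complex.ofRealCLM.hasDerivAt (x := (0 : ℝ))).mul_const (v j)).const_add (ζ j)
  have d2 : scalar v 1 * value Q z + scalar ζ 1 * polyDiff Q z w - polyDiff P z w = 0 := by
    have h := ((hline (Sum.inr (Sum.inr (Sum.inr 1)))).mul (hγ Q)).sub (hγ P)
    have h' := h.unique (h2 (Sum.inr (Sum.inr 1)))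
    rwa [Complex.ofReal_zero, zero_mul, add_zero,
      show (pointOf fun j => ζ j + (0 : ℂ) * v j) = z by simp [hz_def]] at h'
  -- Differentiate `‖z‖² = (scalar ζ 2).re²`, whose right-hand coordinate moves with speed one.
  have d3 : inner ℝ z w = (scalar ζ 2).re := by
    have e1 := Complex.reCLM.hasFDerivAt.comp_hasDerivAt 0 (h2 (Sum.inr (Sum.inr 2)))
    have e2 := hcurve.norm_sq.sub (((Complex.reCLM.hasFDerivAt.comp_hasDerivAt 0
      (hline (Sum.inr (Sum.inr (Sum.inr 2)))))).pow 2)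
    have e3 := e2.unique (e1.congr_of_eventuallyEq (Eventually.of_forall fun s => by
      simp only [Function.comp_apply, Pi.sub_apply, Pi.pow_apply]
      change _ = (∑ j, (starRingEnd ℂ) (pointOf (fun j => ζ j + s * v j) j) *
        pointOf (fun j => ζ j + s * v j) j - _ : ℂ).re
      rw [sum_conj_mul_self, Complex.sub_re, Complex.ofReal_re, Complex.re_ofReal_mul,
        Complex.ofReal_re, pow_two (Complex.reCLM _)]
      rfl))
    have h0 : (pointOf fun j => ζ j + (0 : ℝ) * v j) = z := by simp [hz_def]
    rw [h0] at e3
    have h4' : (v (Sum.inr (Sum.inr (Sum.inr 2)))).re = 1 := h4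
    simp [h4'] at e3
    change _ - 2 * (scalar ζ 2).re = 0 at e3
    linarith
  have hc : ∀ u ∈ tangentSpace S z,
      conjFunctional z u = scalar ζ 0 * value Q z * ratDiff P Q z u := by
    intro u hu
    rw [k2 u, Finset.sum_eq_zero fun p _ => by
      rw [polyDiff_eq_zero_of_mem_tangentSpace hu (hmemG p.1 p.2), mul_zero], hg, ratDiff]
    simp only [sub_apply, smul_apply, smul_eq_mul]
    field_simp
    ring
  have hle := norm_mul_norm_gradOn_le hQz hc
  have hgrad : ε₀ ≤ ‖gradOn S (fun x => (ratFun P Q x).re) z‖ := by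
    by_contra! h
    have : z ∈ (∅ : Set (AffSpace N)) := htame ▸ ⟨hzS, h, by rw [hnorm]; exact h3⟩
    exact this
  have hd : ratDiff P Q z w = scalar v 1 := by
    simp only [ratDiff, sub_apply, smul_apply, smul_eq_mul]
    rw [inv_mul_eq_iff_eq_mul₀ hQz, ← hg]
    linear_combination -d2
  -- With `c = scalar ζ 0 * value Q z`, this reads `‖z‖ = Re (c · dg(w)) ≤ |c||dg(w)|`.
  have hfin : (scalar ζ 2).re ≤ ‖scalar ζ 0 * value Q z‖ * ‖scalar v 1‖ := by
    rw [← d3, ← conjFunctional_re, hc w hw, hd, ← norm_mul]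
    exact Complex.re_le_norm _
  have hpos : 0 < (scalar ζ 2).re := hR₀.trans h3
  have hcpos : 0 < ‖scalar ζ 0 * value Q z‖ := by
    by_contra! h
    have h0 := le_antisymm h (norm_nonneg _)
    rw [h0, zero_mul] at hfin
    linarith
  have := mul_lt_mul_of_pos_left h5 hcpos
  have := mul_le_mul_of_nonneg_left hgrad hcpos.le
  linarith
end
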